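/- **Setting.** Fix $a,b,c\in\{0,1\}$. Consider finite and infinite $\lambda$-trees built from variables, abstractions $\lambda x.s$ and applications $st$, up to $\alpha$-equivalence. The premiss "body of an abstraction" (resp. "function of an application", "argument of an application") is called *coinductive* if $a=1$ (resp. $b=1$, $c=1$) and *inductive* otherwise. In every set of rules below, derivations may be non-wellfounded provided that each infinite branch crosses infinitely many coinductive premisses (that is, the rules define $\nu X_1.\mu X_0.F(X_0,X_1)$, where the inductive premisses are taken in $X_0$ and the coinductive ones in $X_1$). The set $\Lambda^{abc}$ of *$abc$-infinitary $\lambda$-terms* is defined in this way by the rules: $x\in\Lambda^{abc}$; if $s\in\Lambda^{abc}$ then $\lambda x.s\in\Lambda^{abc}$; if $s,t\in\Lambda^{abc}$ then $st\in\Lambda^{abc}$. Truncation is given by $\lfloor s\rfloor_0=\ast$, $\lfloor x\rfloor_{d+1}=x$, $\lfloor\lambda x.s\rfloor_{d+1}=\lambda x.\lfloor s\rfloor_{d+1-a}$, $\lfloor st\rfloor_{d+1}=\lfloor s\rfloor_{d+1-b}\lfloor t\rfloor_{d+1-c}$, and the metric on $\Lambda^{abc}$ is $\mathrm{dist}(s,t)=\inf\{2^{-d}\mid\lfloor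 s\rfloor_d=\lfloor t\rfloor_d\}$. *$\beta$-reduction* with depths is generated inductively by $(\lambda x.s)t\to_0 s[t/x]$ and by: $u\to_d u'$ implies $\lambda x.u\to_{d+a}\lambda x.u'$, $uv\to_{d+b}u'v$ and $vu\to_{d+c}vu'$. We write $\to$ for $\bigcup_d\to_d$ and $\to^*$ for its reflexive-transitive closure. We write $s\to^\infty t$ if, for some ordinal $\gamma$, there are terms $(s_\delta)_{\delta\le\gamma}$ with $s_0=s$, $s_\gamma=t$ and steps $s_\delta\to_{d_\delta}s_{\delta+1}$ ($\delta<\gamma$) such that $\lim_{\delta\to\gamma'}s_\delta=s_{\gamma'}$ and $\lim_{\delta\to\gamma'}d_\delta=\infty$ for every limit ordinal $\gamma'\le\gamma$ (a strongly converging sequence). For each ordinal $\gamma$, relations $\to^\infty_\gamma$ and $\rightsquigarrow_\gamma$ on $\Lambda^{abc}$ are defined, by recursion on $\gamma$, by the following rules, whose premisses $u\to^\infty_\gamma u'$, $v\to^\infty_\gamma v'$ are inductive or coinductive as prescribed by $a,b,c$: - $x\rightsquigarrow_\gamma x$; if $u\to^\infty_\gamma u'$ then $\lambda x.u\rightsquigarrow_\gamma\lambda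 x.u'$; if $u\to^\infty_\gamma u'$ and $v\to^\infty_\gamma v'$ then $uv\rightsquigarrow_\gamma u'v'$; - if $s\Rightarrow_{\gamma,m}s'$ for some $m\in\mathbb N$ and $s'\rightsquigarrow_\gamma t$ then $s\to^\infty_\gamma t$, where $s\Rightarrow_{\gamma,m}s'$ means that there is a sequence $s\to^*s_1\rightsquigarrow_{\delta_1}t_1\to^*s_2\rightsquigarrow_{\delta_2}\cdots\rightsquigarrow_{\delta_m}t_m\to^*s'$ with all $\delta_i<\gamma$. Put $\to^\omega\;:=\;\to^\infty_0$. The *Compression property* is the equality $\to^\infty\;=\;\to^\omega$. Define the properties - $\mathrm P_\delta$: for all $n\in\mathbb N$ and all terms $s,s'$ with $s\Rightarrow_{\delta,n}s'$, there is a term $s''$ such that $s\to^*s''$ and either $s''=s'$ or $s''\rightsquigarrow_\varepsilon^*s'$ for some $\varepsilon<\delta$ (the first alternative matters only for $\delta=0$); - $\mathrm Q$: for all ordinals $\delta$ and terms $s,t,t'$, if $\mathrm P_\delta$ holds and $s\to^\infty_\delta t\to t'$, then there is a term $s'$ such that $s\to^*s'\to^\infty_\delta t'$. Finally, let $\to^{\mathrm{std}}$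 be the relation of the standard coinductive presentation, defined by the rules: if $s\to^*x$ then $s\to^{\mathrm{std}}x$; if $s\to^*\lambda x.u$ and $u\to^{\mathrm{std}}u'$ then $s\to^{\mathrm{std}}\lambda x.u'$; if $s\to^*uv$, $u\to^{\mathrm{std}}u'$ and $v\to^{\mathrm{std}}v'$ then $s\to^{\mathrm{std}}u'v'$; here the premisses on $u$ (body), $u$ (function) and $v$ (argument) are inductive or coinductive as prescribed by $a,b,c$. **Theorem.** For every choice of $a,b,c\in\{0,1\}$: 1. $\beta$-reduction on $\Lambda^{abc}$ satisfies the property $\mathrm Q$; 2. $\beta$-reduction on $\Lambda^{abc}$ has the Compression property: $s\to^\infty t$ if and only if $s\to^\omega t$; 3. for all $s,t\in\Lambda^{abc}$, $s\to^{\mathrm{std}}t$ if and only if $s\to^\infty_\gamma t$ for some $\gamma<\omega_1$, and also if and only if $s\to^\infty t$. -/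

import Mathlib

namespace InfLam

/-! ### Raw (possibly infinite) nameless trees -/

/-- Node labels: de Bruijn variables, abstraction, application, and the extra nullary symbol `∗`
that is only used to mark the places where a term has been truncated. -/
inductive Label : Type
  | star : Label
  | var : ℕ → Label
  | lam : Label
  | app : Label

/-- The number of children of a node. -/
def Label.arity : Label → ℕ
  | .star => 0
  | .var _ => 0
  | .lam => 1
  | .app => 2

/-- The signature of (nameless) λ-trees. -/
def sig : PFunctor.{0, 0} := ⟨Label, fun l => Fin l.arity⟩

/-- All finite and infinite trees over the signature. -/
abbrev Raw : Type := sig.M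

/-- One layer of a tree whose immediate subtrees are taken in `X`. -/
inductive Node (X : Type) : Type
  | star : Node X
  | var : ℕ → Node X
  | lam : X → Node X
  | app : X → X → Node X

namespace Node

def map {X Y : Type} (f : X → Y) : Node X → Node Y
  | star => star
  | var n => var n
  | lam x => lam (f x)
  | app x y => app (f x) (f y)

def toObj {X : Type} : Node X → sig X
  | star => ⟨Label.star, Fin.elim0⟩
  | var n => ⟨Label.var n, Fin.elim0⟩
  | lam x => ⟨Label.lam, fun _ => x⟩
  | app x y => ⟨Label.app, Fin.cons x (Fin.cons y Fin.elim0)⟩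

def ofObj {X : Type} : sig X → Node X
  | ⟨Label.star, _⟩ => star
  | ⟨Label.var n, _⟩ => var n
  | ⟨Label.lam, f⟩ => lam (f (0 : Fin 1))
  | ⟨Label.app, f⟩ => app (f (0 : Fin 2)) (f (1 : Fin 2))

theorem ofObj_toObj {X : Type} (n : Node X) : ofObj n.toObj = n := by
  cases n <;> rfl

theorem toObj_ofObj {X : Type} (o : sig X) : (ofObj o).toObj = o := by
  obtain ⟨l, f⟩ := o
  cases l with
  | star => exact congrArg (Sigma.mk Label.star) (funext fun i => Fin.elim0 i)
  | var n => exact congrArg (Sigma.mk (Label.var n)) (funext fun i => Fin.elim0 i)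
  | lam =>
    refine congrArg (Sigma.mk Label.lam) (funext fun (i : Fin 1) => ?_)
    fin_cases i; rfl
  | app =>
    refine congrArg (Sigma.mk Label.app) (funext fun (i : Fin 2) => ?_)
    fin_cases i <;> rfl

theorem ofObj_map {X Y : Type} (f : X → Y) (o : sig X) :
    ofObj (sig.map f o) = (ofObj o).map f := by
  obtain ⟨l, g⟩ := o
  cases l <;> rfl

end Node

namespace Raw

/-- The tree with a given root layer. -/
def mk (n : Node Raw) : Raw := PFunctor.M.mk (F := sig) n.toObj

/-- The root layer of a tree. -/
def dest (t : Raw) : Node Raw := Node.ofObj (PFunctor.M.dest (F := sig) t)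

/-- Corecursion: unfold a tree from a state space `X`. -/
def unfold {X : Type} (f : X → Node X) (x : X) : Raw :=
  PFunctor.M.corec (F := sig) (fun y => (f y).toObj) x

theorem dest_mk (n : Node Raw) : (mk n).dest = n := by
  unfold dest mk
  rw [PFunctor.M.dest_mk, Node.ofObj_toObj]

theorem mk_dest (t : Raw) : mk t.dest = t := by
  unfold dest mk
  rw [Node.toObj_ofObj, PFunctor.M.mk_dest]

theorem dest_unfold {X : Type} (f : X → Node X) (x : X) :
    (unfold f x).dest = (f x).map (unfold f) := by
  unfold dest unfold
  rw [PFunctor.M.dest_corec, Node.ofObj_map, Node.ofObj_toObj]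

theorem unfold_eq {X : Type} (f : X → Node X) (x : X) :
    unfold f x = mk ((f x).map (unfold f)) := by
  rw [← dest_unfold, mk_dest]

def var (n : ℕ) : Raw := mk (Node.var n)
def lam (s : Raw) : Raw := mk (Node.lam s)
def app (s t : Raw) : Raw := mk (Node.app s t)

/-- Extension of a renaming below a binder. -/
def liftRen (ρ : ℕ → ℕ) : ℕ → ℕ
  | 0 => 0
  | n + 1 => ρ n + 1

def renameStep : (ℕ → ℕ) × Raw → Node ((ℕ → ℕ) × Raw)
  | (ρ, t) =>
    match t.dest with
    | .star => .star
    | .var n => .var (ρ n)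
    | .lam u => .lam (liftRen ρ, u)
    | .app u v => .app (ρ, u) (ρ, v)

/-- Renaming of the free variables. -/
def rename (ρ : ℕ → ℕ) (t : Raw) : Raw := unfold renameStep (ρ, t)

/-- Extension of a substitution below a binder. -/
def up (σ : ℕ → Raw) : ℕ → Raw
  | 0 => var 0
  | n + 1 => rename Nat.succ (σ n)

/-- States: `inr (σ, t)` means that `σ` is still to be applied to `t`; `inl t` means that `t` is
copied unchanged. -/
def substStep : Raw ⊕ ((ℕ → Raw) × Raw) → Node (Raw ⊕ ((ℕ → Raw) × Raw))
  | .inl t => t.dest.map Sum.inl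
  | .inr (σ, t) =>
    match t.dest with
    | .star => .star
    | .var n => (σ n).dest.map Sum.inl
    | .lam u => .lam (.inr (up σ, u))
    | .app u v => .app (.inr (σ, u)) (.inr (σ, v))

/-- Simultaneous capture-avoiding substitution. -/
def subst (σ : ℕ → Raw) (t : Raw) : Raw := unfold substStep (.inr (σ, t))

/-- The substitution sending the variable `0` to `v` and lowering all the other variables. -/
def instSub (v : Raw) : ℕ → Raw
  | 0 => v
  | n + 1 => var n

def truncStep (a b c : Bool) : ℕ × Raw → Node (ℕ × Raw)
  | (0, _) => .star
  | (d + 1, t) =>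
    match t.dest with
    | .star => .star
    | .var n => .var n
    | .lam u => .lam (d + 1 - a.toNat, u)
    | .app u v => .app (d + 1 - b.toNat, u) (d + 1 - c.toNat, v)

/-- The `abc`-truncation at depth `d`. -/
def trunc (a b c : Bool) (d : ℕ) (t : Raw) : Raw := unfold (truncStep a b c) (d, t)

end Raw

/-! ### Mixed inductive-coinductive definitions -/

/-- `ν X₁. μ X₀. F X₀ X₁`. -/
def nuMu {α : Type*} [CompleteLattice α] (F : α → α → α)
    (hF : ∀ x x' y y', x ≤ x' → y ≤ y' → F x y ≤ F x' y') : α :=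
  OrderHom.gfp
    { toFun := fun X₁ => OrderHom.lfp
        { toFun := fun X₀ => F X₀ X₁
          monotone' := fun _ _ h => hF _ _ _ _ h le_rfl }
      monotone' := fun _ _ h => OrderHom.lfp.monotone fun _ => hF _ _ _ _ le_rfl h }

/-- A premiss guarded by `later e` is inductive if `e = 0` and coinductive if `e = 1`. -/
def later {α : Type*} (e : Bool) (X₀ X₁ : α) : α := if e then X₁ else X₀

theorem later_mono {α : Type*} [Preorder α] (e : Bool) {x x' y y' : α} (hx : x ≤ x')
    (hy : y ≤ y') : later e x y ≤ later e x' y' := by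
  cases e
  · exact hx
  · exact hy

theorem nuMu_fold {α : Type*} [CompleteLattice α] (F : α → α → α)
    (hF : ∀ x x' y y', x ≤ x' → y ≤ y' → F x y ≤ F x' y') :
    F (nuMu F hF) (nuMu F hF) = nuMu F hF := by
  have h1 : OrderHom.lfp { toFun := fun X₀ => F X₀ (nuMu F hF)
                           monotone' := fun _ _ h => hF _ _ _ _ h le_rfl } = nuMu F hF :=
    OrderHom.map_gfp (α := α)
      { toFun := fun X₁ => OrderHom.lfp
          { toFun := fun X₀ => F X₀ X₁
            monotone' := fun _ _ h => hF _ _ _ _ h le_rfl }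
        monotone' := fun _ _ h => OrderHom.lfp.monotone fun _ => hF _ _ _ _ le_rfl h }
  have h2 := OrderHom.map_lfp (α := α)
    { toFun := fun X₀ => F X₀ (nuMu F hF)
      monotone' := fun _ _ h => hF _ _ _ _ h le_rfl }
  rw [h1] at h2
  exact h2

/-- Coinduction for `nuMu`: it suffices to find `C` such that every pre-fixed point of `F · C`
lies above `C`. -/
theorem le_nuMu {α : Type*} [CompleteLattice α] (F : α → α → α)
    (hF : ∀ x x' y y', x ≤ x' → y ≤ y' → F x y ≤ F x' y') (C : α)
    (h : ∀ I, F I C ≤ I → C ≤ I) : C ≤ nuMu F hF :=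
  OrderHom.le_gfp _ (OrderHom.le_lfp _ h)

/-- Induction for `nuMu`. -/
theorem nuMu_le {α : Type*} [CompleteLattice α] (F : α → α → α)
    (hF : ∀ x x' y y', x ≤ x' → y ≤ y' → F x y ≤ F x' y') (I : α)
    (h : F I (nuMu F hF) ≤ I) : nuMu F hF ≤ I := by
  have h1 : OrderHom.lfp { toFun := fun X₀ => F X₀ (nuMu F hF)
                           monotone' := fun _ _ h => hF _ _ _ _ h le_rfl } = nuMu F hF :=
    OrderHom.map_gfp (α := α)
      { toFun := fun X₁ => OrderHom.lfp
          { toFun := fun X₀ => F X₀ X₁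
            monotone' := fun _ _ h => hF _ _ _ _ h le_rfl }
        monotone' := fun _ _ h => OrderHom.lfp.monotone fun _ => hF _ _ _ _ le_rfl h }
  rw [← h1]
  exact OrderHom.lfp_le _ h

/-! ### The `abc`-infinitary λ-terms -/

/-- The formation rules of `abc`-infinitary λ-terms. -/
inductive TermRule (a b c : Bool) (X₀ X₁ : Set Raw) : Raw → Prop
  | var (n : ℕ) : TermRule a b c X₀ X₁ (Raw.var n)
  | lam {s : Raw} : s ∈ later a X₀ X₁ → TermRule a b c X₀ X₁ (Raw.lam s)
  | app {s t : Raw} : s ∈ later b X₀ X₁ → t ∈ later c X₀ X₁ →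
      TermRule a b c X₀ X₁ (Raw.app s t)

theorem termRule_mono (a b c : Bool) (x x' y y' : Set Raw) (hx : x ≤ x') (hy : y ≤ y') :
    {t | TermRule a b c x y t} ≤ {t | TermRule a b c x' y' t} := by
  rintro t (n | h | ⟨h, h'⟩)
  · exact .var n
  · exact .lam (later_mono a hx hy h)
  · exact .app (later_mono b hx hy h) (later_mono c hx hy h')

/-- The trees derivable by the formation rules, with inductive and coinductive premisses as
prescribed by `a`, `b`, `c`. -/
def termSet (a b c : Bool) : Set Raw :=
  nuMu (fun X₀ X₁ => {t | TermRule a b c X₀ X₁ t}) (termRule_mono a b c)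

/-- The set `Λ^{abc}` of `abc`-infinitary λ-terms (up to α-equivalence). -/
def Term (a b c : Bool) : Type := {t : Raw // t ∈ termSet a b c}

theorem termSet_fold (a b c : Bool) :
    {t | TermRule a b c (termSet a b c) (termSet a b c) t} = termSet a b c :=
  nuMu_fold _ (termRule_mono a b c)

theorem later_self {α : Type*} (e : Bool) (x : α) : later e x x = x := by
  cases e <;> rfl

theorem var_mem (a b c : Bool) (n : ℕ) : Raw.var n ∈ termSet a b c := by
  rw [← termSet_fold]
  exact TermRule.var n

theorem lam_mem {a b c : Bool} {s : Raw} (hs : s ∈ termSet a b c) :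
    Raw.lam s ∈ termSet a b c := by
  rw [← termSet_fold]
  exact TermRule.lam (by rwa [later_self])

theorem app_mem {a b c : Bool} {s t : Raw} (hs : s ∈ termSet a b c) (ht : t ∈ termSet a b c) :
    Raw.app s t ∈ termSet a b c := by
  rw [← termSet_fold]
  exact TermRule.app (by rwa [later_self]) (by rwa [later_self])

theorem rename_var (ρ : ℕ → ℕ) (n : ℕ) : (Raw.var n).rename ρ = Raw.var (ρ n) := by
  unfold Raw.rename
  rw [Raw.unfold_eq]
  simp only [Raw.renameStep, Raw.var, Raw.dest_mk, Node.map]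

theorem rename_lam (ρ : ℕ → ℕ) (s : Raw) :
    (Raw.lam s).rename ρ = Raw.lam (s.rename (Raw.liftRen ρ)) := by
  conv_lhs => unfold Raw.rename
  rw [Raw.unfold_eq]
  simp only [Raw.renameStep, Raw.lam, Raw.dest_mk, Node.map, Raw.rename]

theorem rename_app (ρ : ℕ → ℕ) (s t : Raw) :
    (Raw.app s t).rename ρ = Raw.app (s.rename ρ) (t.rename ρ) := by
  conv_lhs => unfold Raw.rename
  rw [Raw.unfold_eq]
  simp only [Raw.renameStep, Raw.app, Raw.dest_mk, Node.map, Raw.rename]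

/-- Copying a tree through the left states of `substStep` gives the same tree. -/
theorem unfold_substStep_inl (t : Raw) : Raw.unfold Raw.substStep (.inl t) = t := by
  have h := PFunctor.M.corec_unique (P := sig) (fun t : Raw => t.dest.toObj)
  have h1 : (fun t : Raw => Raw.unfold Raw.substStep (.inl t)) =
      PFunctor.M.corec (F := sig) (fun t : Raw => t.dest.toObj) := by
    refine h _ fun x => ?_
    have := Raw.dest_unfold Raw.substStep (.inl x)
    have h2 := congrArg Node.toObj this
    unfold Raw.dest at h2
    rw [Node.toObj_ofObj] at h2
    rw [h2]
    simp only [Raw.substStep]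
    cases x.dest with
    | star => exact congrArg (Sigma.mk Label.star) (funext fun i => Fin.elim0 i)
    | var n => exact congrArg (Sigma.mk (Label.var n)) (funext fun i => Fin.elim0 i)
    | lam u => rfl
    | app u v =>
      refine congrArg (Sigma.mk Label.app) (funext fun (i : Fin 2) => ?_)
      fin_cases i <;> rfl
  have h3 : (fun t : Raw => t) =
      PFunctor.M.corec (F := sig) (fun t : Raw => t.dest.toObj) := by
    refine h _ fun x => ?_
    simp only [Raw.dest, Node.toObj_ofObj]
    exact (PFunctor.id_map sig _).symm
  exact congrFun (h1.trans h3.symm) t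

theorem subst_var (σ : ℕ → Raw) (n : ℕ) : (Raw.var n).subst σ = σ n := by
  unfold Raw.subst
  rw [Raw.unfold_eq]
  simp only [Raw.substStep, Raw.var, Raw.dest_mk]
  rw [← unfold_substStep_inl (σ n), Raw.unfold_eq]
  simp only [Raw.substStep]
  congr 1
  cases h : (σ n).dest <;> simp [Raw.dest_mk, Node.map, unfold_substStep_inl]

theorem subst_lam (σ : ℕ → Raw) (s : Raw) :
    (Raw.lam s).subst σ = Raw.lam (s.subst (Raw.up σ)) := by
  conv_lhs => unfold Raw.subst
  rw [Raw.unfold_eq]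
  simp only [Raw.substStep, Raw.lam, Raw.dest_mk, Node.map, Raw.subst]

theorem subst_app (σ : ℕ → Raw) (s t : Raw) :
    (Raw.app s t).subst σ = Raw.app (s.subst σ) (t.subst σ) := by
  conv_lhs => unfold Raw.subst
  rw [Raw.unfold_eq]
  simp only [Raw.substStep, Raw.app, Raw.dest_mk, Node.map, Raw.subst]

theorem rename_mem {a b c : Bool} {t : Raw} (ht : t ∈ termSet a b c) (ρ : ℕ → ℕ) :
    t.rename ρ ∈ termSet a b c := by
  let C : Set Raw := {r | ∃ s ∈ termSet a b c, ∃ ρ, r = s.rename ρ}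
  suffices h : C ≤ termSet a b c from h ⟨t, ht, ρ, rfl⟩
  refine le_nuMu _ _ C fun I hI => ?_
  have key : termSet a b c ≤ {s | ∀ ρ, s.rename ρ ∈ I} := by
    refine nuMu_le _ _ _ ?_
    have hl : ∀ (e : Bool) (s : Raw), s ∈ later e {s : Raw | ∀ ρ, s.rename ρ ∈ I}
        (termSet a b c) → ∀ ρ, s.rename ρ ∈ later e I C := by
      intro e s hs ρ
      cases e
      · exact hs ρ
      · exact ⟨s, hs, ρ, rfl⟩
    rintro s (n | h | ⟨h, h'⟩) ρ
    · rw [rename_var]; exact hI (.var _)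
    · rw [rename_lam]; exact hI (.lam (hl _ _ h _))
    · rw [rename_app]; exact hI (.app (hl _ _ h _) (hl _ _ h' _))
  rintro r ⟨s, hs, ρ, rfl⟩
  exact key hs ρ

theorem subst_mem {a b c : Bool} {t : Raw} (ht : t ∈ termSet a b c) (σ : ℕ → Raw)
    (hσ : ∀ n, σ n ∈ termSet a b c) : t.subst σ ∈ termSet a b c := by
  have hup : ∀ σ : ℕ → Raw, (∀ n, σ n ∈ termSet a b c) → ∀ n, Raw.up σ n ∈ termSet a b c := by
    intro σ hσ n
    cases n with
    | zero => exact var_mem a b c 0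
    | succ n => exact rename_mem (hσ n) _
  let C : Set Raw := termSet a b c ∪
    {r | ∃ s ∈ termSet a b c, ∃ σ : ℕ → Raw, (∀ n, σ n ∈ termSet a b c) ∧ r = s.subst σ}
  suffices h : C ≤ termSet a b c from h (Or.inr ⟨t, ht, σ, hσ, rfl⟩)
  refine le_nuMu _ _ C fun I hI => ?_
  have key0 : termSet a b c ≤ I := by
    refine nuMu_le _ _ _ (le_trans ?_ hI)
    exact termRule_mono a b c _ _ _ _ le_rfl fun x hx => Or.inl hx
  have key : termSet a b c ≤
      {s | ∀ σ : ℕ → Raw, (∀ n, σ n ∈ termSet a b c) → s.subst σ ∈ I} := by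
    refine nuMu_le _ _ _ ?_
    have hl : ∀ (e : Bool) (s : Raw), s ∈ later e
        {s : Raw | ∀ σ : ℕ → Raw, (∀ n, σ n ∈ termSet a b c) → s.subst σ ∈ I}
        (termSet a b c) → ∀ σ : ℕ → Raw, (∀ n, σ n ∈ termSet a b c) →
          s.subst σ ∈ later e I C := by
      intro e s hs σ hσ
      cases e
      · exact hs σ hσ
      · exact Or.inr ⟨s, hs, σ, hσ, rfl⟩
    rintro s (n | h | ⟨h, h'⟩) σ hσ
    · rw [subst_var]; exact key0 (hσ n)
    · rw [subst_lam]; exact hI (.lam (hl _ _ h _ (hup _ hσ)))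
    · rw [subst_app]; exact hI (.app (hl _ _ h _ hσ) (hl _ _ h' _ hσ))
  rintro r (hr | ⟨s, hs, σ, hσ, rfl⟩)
  · exact key0 hr
  · exact key hs σ hσ

theorem instSub_mem {a b c : Bool} {v : Raw} (hv : v ∈ termSet a b c) (n : ℕ) :
    Raw.instSub v n ∈ termSet a b c := by
  cases n with
  | zero => exact hv
  | succ n => exact var_mem a b c n

namespace Term

variable {a b c : Bool}

def var (n : ℕ) : Term a b c := ⟨Raw.var n, var_mem a b c n⟩
def lam (s : Term a b c) : Term a b c := ⟨Raw.lam s.1, lam_mem s.2⟩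
def app (s t : Term a b c) : Term a b c := ⟨Raw.app s.1 t.1, app_mem s.2 t.2⟩

/-- `inst u v` is `u[v/x]` where `x` is the variable bound by the outer abstraction in `λx.u`. -/
def inst (u v : Term a b c) : Term a b c :=
  ⟨u.1.subst (Raw.instSub v.1), subst_mem u.2 _ (instSub_mem v.2)⟩

/-- The metric `d(s,t) = inf {2⁻ᵈ | s and t have the same abc-truncation at depth d}`. -/
noncomputable def dist (s t : Term a b c) : ℝ :=
  sInf {x : ℝ | ∃ d : ℕ, x = (1 / 2) ^ d ∧ s.1.trunc a b c d = t.1.trunc a b c d}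

end Term

/-! ### β-reduction and strongly converging reduction sequences -/

/-- `BetaAt d s t`: a β-reduction step from `s` to `t` at depth `d`. -/
inductive BetaAt {a b c : Bool} : ℕ → Term a b c → Term a b c → Prop
  | beta (u v : Term a b c) : BetaAt 0 (Term.app (Term.lam u) v) (Term.inst u v)
  | lam {d : ℕ} {u u' : Term a b c} : BetaAt d u u' →
      BetaAt (d + a.toNat) (Term.lam u) (Term.lam u')
  | appL {d : ℕ} {u u' v : Term a b c} : BetaAt d u u' →
      BetaAt (d + b.toNat) (Term.app u v) (Term.app u' v)
  | appR {d : ℕ} {u v v' : Term a b c} : BetaAt d v v' →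
      BetaAt (d + c.toNat) (Term.app u v) (Term.app u v')

/-- β-reduction. -/
def Beta {a b c : Bool} (s t : Term a b c) : Prop := ∃ d, BetaAt d s t

/-- Finite β-reduction sequences. -/
def BetaStar {a b c : Bool} : Term a b c → Term a b c → Prop := Relation.ReflTransGen Beta

/-- A strongly converging β-reduction sequence of length `γ`, given by its terms `s δ` (`δ ≤ γ`)
and the depths `d δ` (`δ < γ`) of its steps. -/
structure IsStronglyConverging {a b c : Bool} (γ : Ordinal.{0}) (s : Ordinal.{0} → Term a b c)
    (d : Ordinal.{0} → ℕ) : Prop where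
  step : ∀ δ < γ, BetaAt (d δ) (s δ) (s (δ + 1))
  tendsto_term : ∀ γ' ≤ γ, Order.IsSuccLimit γ' →
    ∀ ε > 0, ∃ δ₀ < γ', ∀ δ, δ₀ ≤ δ → δ < γ' → Term.dist (s δ) (s γ') < ε
  tendsto_depth : ∀ γ' ≤ γ, Order.IsSuccLimit γ' →
    ∀ N : ℕ, ∃ δ₀ < γ', ∀ δ, δ₀ ≤ δ → δ < γ' → N ≤ d δ

/-- Infinitary β-reduction `s ⟶^∞ t`: there is a strongly converging β-reduction sequence, of some
ordinal length, from `s` to `t`. -/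
def RedInf {a b c : Bool} (s t : Term a b c) : Prop :=
  ∃ (γ : Ordinal.{0}) (r : Ordinal.{0} → Term a b c) (d : Ordinal.{0} → ℕ),
    IsStronglyConverging γ r d ∧ r 0 = s ∧ r γ = t

/-! ### The coinductive presentation with ordinal annotations -/

/-- The rules `lift`. -/
inductive Lift {a b c : Bool} (X₀ X₁ : Term a b c → Term a b c → Prop) :
    Term a b c → Term a b c → Prop
  | var (n : ℕ) : Lift X₀ X₁ (Term.var n) (Term.var n)
  | lam {u u' : Term a b c} : later a X₀ X₁ u u' → Lift X₀ X₁ (Term.lam u) (Term.lam u')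
  | app {u u' v v' : Term a b c} : later b X₀ X₁ u u' → later c X₀ X₁ v v' →
      Lift X₀ X₁ (Term.app u v) (Term.app u' v')

theorem lift_mono {a b c : Bool} (x x' y y' : Term a b c → Term a b c → Prop) (hx : x ≤ x')
    (hy : y ≤ y') : Lift x y ≤ Lift x' y' := by
  rintro s t (n | h | ⟨h, h'⟩)
  · exact .var n
  · exact .lam (later_mono a hx hy _ _ h)
  · exact .app (later_mono b hx hy _ _ h) (later_mono c hx hy _ _ h')

/-- `SeqOf G m s s'`: a sequence `s ⟶* s₁ G t₁ ⟶* s₂ G t₂ ⟶* … s_m G t_m ⟶* s'`. -/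
inductive SeqOf {a b c : Bool} (G : Term a b c → Term a b c → Prop) :
    ℕ → Term a b c → Term a b c → Prop
  | zero {s s' : Term a b c} : BetaStar s s' → SeqOf G 0 s s'
  | succ {m : ℕ} {s s₁ t₁ s' : Term a b c} : BetaStar s s₁ → G s₁ t₁ → SeqOf G m t₁ s' →
      SeqOf G (m + 1) s s'

/-- The rule `split`, followed by a rule `lift`. -/
def SplitLift {a b c : Bool} (G X₀ X₁ : Term a b c → Term a b c → Prop) (s t : Term a b c) :
    Prop :=
  ∃ m s', SeqOf G m s s' ∧ Lift X₀ X₁ s' t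

theorem splitLift_mono {a b c : Bool} (G x x' y y' : Term a b c → Term a b c → Prop) (hx : x ≤ x')
    (hy : y ≤ y') : SplitLift G x y ≤ SplitLift G x' y' :=
  fun _ _ ⟨m, s', h, h'⟩ => ⟨m, s', h, lift_mono _ _ _ _ hx hy _ _ h'⟩

/-- The relation defined by the rules `split` and `lift`, where `G` is the union of the auxiliary
relations allowed in the first premiss of `split`. -/
def RedOf {a b c : Bool} (G : Term a b c → Term a b c → Prop) :
    Term a b c → Term a b c → Prop :=
  nuMu (SplitLift G) (splitLift_mono G)

/-- The auxiliary relation `s ⇝_γ t`, whose derivations end with a rule `lift`. -/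
def RedIG {a b c : Bool} (γ : Ordinal.{0}) : Term a b c → Term a b c → Prop :=
  Lift (RedOf fun s t => ∃ δ, ∃ _ : δ < γ, RedIG δ s t)
    (RedOf fun s t => ∃ δ, ∃ _ : δ < γ, RedIG δ s t)
termination_by γ

/-- The union of the relations `⇝_δ` for `δ < γ`. -/
def RedIGBelow {a b c : Bool} (γ : Ordinal.{0}) (s t : Term a b c) : Prop :=
  ∃ δ < γ, RedIG δ s t

/-- The relation `s ⟶^∞_γ t`, whose derivations end with the rule `split`. -/
def RedI {a b c : Bool} (γ : Ordinal.{0}) : Term a b c → Term a b c → Prop :=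
  RedOf (RedIGBelow γ)

/-- The coinductive presentation of infinitary β-reduction: the union of the `⟶^∞_γ` over all the
countable ordinals `γ`. -/
def RedCoind {a b c : Bool} (s t : Term a b c) : Prop :=
  ∃ γ < Ordinal.omega.{0} 1, RedI γ s t

/-- Compressed infinitary β-reduction `s ⟶^ω t`. -/
def RedOmega {a b c : Bool} : Term a b c → Term a b c → Prop := RedI 0

/-! ### The properties -/

/-- The property `P_δ`. The first disjunct only matters for `δ = 0`, where `P_0` holds trivially. -/
def PropertyP (a b c : Bool) (δ : Ordinal.{0}) : Prop :=
  ∀ (n : ℕ) (s s' : Term a b c), SeqOf (RedIGBelow δ) n s s' →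
    ∃ s'' : Term a b c, BetaStar s s'' ∧
      (s'' = s' ∨ ∃ ε < δ, Relation.ReflTransGen (RedIG ε) s'' s')

/-- The property `Q`. -/
def PropertyQ (a b c : Bool) : Prop :=
  ∀ (δ : Ordinal.{0}) (s t t' : Term a b c), PropertyP a b c δ → RedI δ s t → Beta t t' →
    ∃ s' : Term a b c, BetaStar s s' ∧ RedI δ s' t'

/-- The Compression property: `⟶^∞` and `⟶^ω` are the same relation. -/
def HasCompression (a b c : Bool) : Prop :=
  ∀ s t : Term a b c, RedInf s t ↔ RedOmega s t

/-! ### The standard coinductive presentation -/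

/-- The rules of the standard coinductive presentation of infinitary β-reduction. -/
inductive StdRule {a b c : Bool} (X₀ X₁ : Term a b c → Term a b c → Prop) :
    Term a b c → Term a b c → Prop
  | var {s : Term a b c} {n : ℕ} : BetaStar s (Term.var n) → StdRule X₀ X₁ s (Term.var n)
  | lam {s u u' : Term a b c} : BetaStar s (Term.lam u) → later a X₀ X₁ u u' →
      StdRule X₀ X₁ s (Term.lam u')
  | app {s u u' v v' : Term a b c} : BetaStar s (Term.app u v) → later b X₀ X₁ u u' →
      later c X₀ X₁ v v' → StdRule X₀ X₁ s (Term.app u' v')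

theorem stdRule_mono {a b c : Bool} (x x' y y' : Term a b c → Term a b c → Prop) (hx : x ≤ x')
    (hy : y ≤ y') : StdRule x y ≤ StdRule x' y' := by
  rintro s t (h | ⟨h, h1⟩ | ⟨h, h1, h2⟩)
  · exact .var h
  · exact .lam h (later_mono a hx hy _ _ h1)
  · exact .app h (later_mono b hx hy _ _ h1) (later_mono c hx hy _ _ h2)

/-- Infinitary β-reduction in the standard coinductive presentation. -/
def RedStd {a b c : Bool} : Term a b c → Term a b c → Prop :=
  nuMu StdRule stdRule_mono

end InfLam

namespace InfLam

/-! ### Bisimulation and the substitution calculus on raw trees -/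

namespace Raw

/-! Everything is compared with the standard presentation `RedStd`. At level 0 the auxiliary
sequences are just finite β-reductions, so `RedI 0` and `RedStd` have the same generating rules. The
core of the proof is that `RedStd` is transitive. It absorbs finite reductions on the left by its
rules. It absorbs a β-step on the right (`RedStd.tail_betaAt`) because a derivation ending in a
redex can be inverted to a finite reduction to a redex, which is contracted; compatibility with
simultaneous substitution (`RedStd.subst`) then relates the contracta. Coinduction turns these facts
into `RedStd.trans`.

Transitivity collapses the ordinal hierarchy: by induction on γ, every premiss sequence of `RedI γ`
is contained in `RedStd` (`redI_iff_redStd`). Property Q follows, the β-step being absorbed with an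
empty finite reduction.

A strongly converging sequence lies in `RedStd` by induction on its length. At a limit
(`Converges.redStd_limit`), an initial segment is handled by the induction hypothesis; the rest
agrees with the limit term at depth 1 and only reduces at depth at least 1, so it splits into
converging sequences between immediate subterms, to which coinduction applies.

Conversely, a `RedStd` derivation is unwound depth by depth: finitely many steps at depth at least d
bring the source to a term that still has to be reduced only at depth d + 1 (`RedFrom.exists_succ`).
Concatenating these reductions gives a sequence of length at most ω. Compression is the conjunction
of the two directions. -/

def star : Raw := mk Node.star

theorem cases (t : Raw) :
    t = star ∨ (∃ n, t = var n) ∨ (∃ u, t = lam u) ∨ ∃ u v, t = app u v := by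
  rw [← mk_dest t]
  rcases t.dest with _ | n | u | ⟨u, v⟩
  · exact .inl rfl
  · exact .inr (.inl ⟨n, rfl⟩)
  · exact .inr (.inr (.inl ⟨u, rfl⟩))
  · exact .inr (.inr (.inr ⟨u, v, rfl⟩))

theorem mk_injective : Function.Injective mk := fun m n h => by
  rw [← dest_mk m, h, dest_mk]

theorem var_inj {m n : ℕ} (h : var m = var n) : m = n := Node.var.inj (mk_injective h)

theorem lam_inj {u v : Raw} (h : lam u = lam v) : u = v := Node.lam.inj (mk_injective h)

theorem app_inj {u v u' v' : Raw} (h : app u v = app u' v') : u = u' ∧ v = v' :=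
  Node.app.inj (mk_injective h)

theorem var_ne_lam {n : ℕ} {u : Raw} : var n ≠ lam u := fun h => nomatch mk_injective h

theorem var_ne_app {n : ℕ} {u v : Raw} : var n ≠ app u v := fun h => nomatch mk_injective h

theorem lam_ne_app {w u v : Raw} : lam w ≠ app u v := fun h => nomatch mk_injective h

/-- Two trees that are equal, or have the same root and `R`-related immediate subtrees. -/
inductive Layer (R : Raw → Raw → Prop) : Raw → Raw → Prop
  | refl (s : Raw) : Layer R s s
  | lam {u u' : Raw} : R u u' → Layer R (lam u) (lam u')
  | app {u u' v v' : Raw} : R u u' → R v v' → Layer R (app u v) (app u' v')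

/-- Bisimulation up to reflexivity: `R` is enlarged by equality, so that leaves and identical
subtrees need no further justification. -/
theorem bisim (R : Raw → Raw → Prop) (h : ∀ s t, R s t → Layer R s t) {s t : Raw}
    (hst : R s t) : s = t := by
  refine PFunctor.M.bisim (fun x y => R x y ∨ x = y) ?_ s t (.inl hst)
  rintro x y (hxy | rfl)
  · rcases h x y hxy with _ | @⟨u, u', hu⟩ | @⟨u, u', v, v', hu, hv⟩
    · exact ⟨_, _, _, rfl, rfl, fun _ => .inr rfl⟩
    · exact ⟨_, _, _, PFunctor.M.dest_mk _, PFunctor.M.dest_mk _, fun _ => .inl hu⟩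
    · refine ⟨_, _, _, PFunctor.M.dest_mk _, PFunctor.M.dest_mk _, fun (i : Fin 2) => ?_⟩
      fin_cases i
      · exact .inl hu
      · exact .inl hv
  · exact ⟨_, _, _, rfl, rfl, fun _ => .inr rfl⟩

theorem rename_star (ρ : ℕ → ℕ) : star.rename ρ = star := by
  unfold rename
  rw [unfold_eq]
  simp only [renameStep, star, dest_mk, Node.map]

theorem subst_star (σ : ℕ → Raw) : star.subst σ = star := by
  unfold subst
  rw [unfold_eq]
  simp only [substStep, star, dest_mk, Node.map]

theorem up_var_comp (ρ : ℕ → ℕ) : up (fun n => var (ρ n)) = fun n => var (liftRen ρ n) := by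
  funext n
  cases n with
  | zero => rfl
  | succ n => exact rename_var _ _

/-- Renaming has its own corecursion because `up` needs it; this identification lets later facts
about renaming be read off from substitution. -/
theorem rename_eq_subst (ρ : ℕ → ℕ) (t : Raw) : t.rename ρ = t.subst fun n => var (ρ n) := by
  refine bisim (fun x y => ∃ ρ t, x = rename ρ t ∧ y = subst (fun n => var (ρ n)) t) ?_
    ⟨ρ, t, rfl, rfl⟩
  rintro _ _ ⟨ρ, t, rfl, rfl⟩
  rcases t.cases with rfl | ⟨n, rfl⟩ | ⟨u, rfl⟩ | ⟨u, v, rfl⟩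
  · rw [rename_star, subst_star]; exact .refl _
  · rw [rename_var, subst_var]; exact .refl _
  · rw [rename_lam, subst_lam, up_var_comp]; exact .lam ⟨_, _, rfl, rfl⟩
  · rw [rename_app, subst_app]; exact .app ⟨_, _, rfl, rfl⟩ ⟨_, _, rfl, rfl⟩

theorem subst_rename (ρ : ℕ → ℕ) (σ : ℕ → Raw) (t : Raw) :
    (t.rename ρ).subst σ = t.subst fun n => σ (ρ n) := by
  refine bisim (fun x y => ∃ ρ σ t, x = subst σ (rename ρ t) ∧ y = subst (fun n => σ (ρ n)) t) ?_
    ⟨ρ, σ, t, rfl, rfl⟩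
  rintro _ _ ⟨ρ, σ, t, rfl, rfl⟩
  rcases t.cases with rfl | ⟨n, rfl⟩ | ⟨u, rfl⟩ | ⟨u, v, rfl⟩
  · rw [rename_star, subst_star, subst_star]; exact .refl _
  · rw [rename_var, subst_var, subst_var]; exact .refl _
  · have h : up (fun n => σ (ρ n)) = fun n => up σ (liftRen ρ n) := by
      funext n; cases n <;> rfl
    rw [rename_lam, subst_lam, subst_lam, h]; exact .lam ⟨_, _, _, rfl, rfl⟩
  · rw [rename_app, subst_app, subst_app]; exact .app ⟨_, _, _, rfl, rfl⟩ ⟨_, _, _, rfl, rfl⟩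

theorem rename_rename (ρ ρ' : ℕ → ℕ) (t : Raw) :
    (t.rename ρ).rename ρ' = t.rename fun n => ρ' (ρ n) := by
  rw [rename_eq_subst ρ', subst_rename, rename_eq_subst]

theorem rename_subst (σ : ℕ → Raw) (ρ : ℕ → ℕ) (t : Raw) :
    (t.subst σ).rename ρ = t.subst fun n => (σ n).rename ρ := by
  refine bisim (fun x y => ∃ ρ σ t, x = rename ρ (subst σ t) ∧
    y = subst (fun n => (σ n).rename ρ) t) ?_ ⟨ρ, σ, t, rfl, rfl⟩
  rintro _ _ ⟨ρ, σ, t, rfl, rfl⟩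
  rcases t.cases with rfl | ⟨n, rfl⟩ | ⟨u, rfl⟩ | ⟨u, v, rfl⟩
  · rw [subst_star, rename_star, subst_star]; exact .refl _
  · rw [subst_var, subst_var]; exact .refl _
  · have h : up (fun n => (σ n).rename ρ) = fun n => (up σ n).rename (liftRen ρ) := by
      funext n
      cases n with
      | zero => simp only [up, InfLam.rename_var, liftRen]
      | succ n => simp only [up, rename_rename, liftRen, Nat.succ_eq_add_one]
    rw [subst_lam, subst_lam, rename_lam, h]; exact .lam ⟨_, _, _, rfl, rfl⟩
  · rw [subst_app, rename_app, subst_app]; exact .app ⟨_, _, _, rfl, rfl⟩ ⟨_, _, _, rfl, rfl⟩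

/-- The composite substitution must commute with `up`. On a successor this is an exchange with the
shift, which the two mixed laws `subst_rename` and `rename_subst` provide. -/
theorem subst_subst (σ τ : ℕ → Raw) (t : Raw) :
    (t.subst σ).subst τ = t.subst fun n => (σ n).subst τ := by
  refine bisim (fun x y => ∃ σ τ t, x = subst τ (subst σ t) ∧
    y = subst (fun n => (σ n).subst τ) t) ?_ ⟨σ, τ, t, rfl, rfl⟩
  rintro _ _ ⟨σ, τ, t, rfl, rfl⟩
  rcases t.cases with rfl | ⟨n, rfl⟩ | ⟨u, rfl⟩ | ⟨u, v, rfl⟩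
  · rw [subst_star, subst_star, subst_star]; exact .refl _
  · rw [subst_var, subst_var]; exact .refl _
  · have h : up (fun n => (σ n).subst τ) = fun n => (up σ n).subst (up τ) := by
      funext n
      cases n with
      | zero => simp only [up, InfLam.subst_var]
      | succ n => simp only [up, subst_rename, rename_subst]
    rw [subst_lam, subst_lam, subst_lam, h]; exact .lam ⟨_, _, _, rfl, rfl⟩
  · rw [subst_app, subst_app, subst_app]; exact .app ⟨_, _, _, rfl, rfl⟩ ⟨_, _, _, rfl, rfl⟩

theorem subst_id (t : Raw) : t.subst var = t := by
  refine bisim (fun x y => x = subst var y) ?_ rfl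
  rintro _ t rfl
  rcases t.cases with rfl | ⟨n, rfl⟩ | ⟨u, rfl⟩ | ⟨u, v, rfl⟩
  · rw [subst_star]; exact .refl _
  · rw [subst_var]; exact .refl _
  · have h : up var = var := by
      funext n
      cases n with
      | zero => rfl
      | succ n => exact InfLam.rename_var _ _
    rw [subst_lam, h]; exact .lam rfl
  · rw [subst_app]; exact .app rfl rfl

/-- The substitution lemma behind stability of β-steps. Both sides are single substitutions by
`subst_subst`, so it suffices to compare them on each variable. -/
theorem subst_instSub (σ : ℕ → Raw) (u v : Raw) :
    (u.subst (instSub v)).subst σ = (u.subst (up σ)).subst (instSub (v.subst σ)) := by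
  rw [subst_subst, subst_subst]
  congr 1
  funext n
  cases n with
  | zero => simp only [instSub, up, InfLam.subst_var]
  | succ n =>
    simp only [instSub, up, InfLam.subst_var, subst_rename]
    exact (subst_id _).symm

/-! ### Truncation -/

variable {a b c : Bool}

theorem trunc_zero (t : Raw) : t.trunc a b c 0 = star := by
  unfold trunc
  rw [unfold_eq]
  rfl

theorem trunc_star (d : ℕ) : star.trunc a b c d = star := by
  cases d with
  | zero => exact trunc_zero _
  | succ d =>
    unfold trunc
    rw [unfold_eq]
    simp only [truncStep, star, dest_mk, Node.map]

theorem trunc_var (d n : ℕ) : (var n).trunc a b c (d + 1) = var n := by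
  unfold trunc
  rw [unfold_eq]
  simp only [truncStep, var, dest_mk, Node.map]

theorem trunc_lam (d : ℕ) (u : Raw) :
    (lam u).trunc a b c (d + 1) = lam (u.trunc a b c (d + 1 - a.toNat)) := by
  conv_lhs => unfold trunc
  rw [unfold_eq]
  simp only [truncStep, lam, dest_mk, Node.map, trunc]

theorem trunc_app (d : ℕ) (u v : Raw) : (app u v).trunc a b c (d + 1) =
    app (u.trunc a b c (d + 1 - b.toNat)) (v.trunc a b c (d + 1 - c.toNat)) := by
  conv_lhs => unfold trunc
  rw [unfold_eq]
  simp only [truncStep, app, dest_mk, Node.map, trunc]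

theorem trunc_trunc {e d : ℕ} (h : e ≤ d) (t : Raw) :
    (t.trunc a b c d).trunc a b c e = t.trunc a b c e := by
  refine bisim (fun x y => ∃ e d t, e ≤ d ∧ x = trunc a b c e (trunc a b c d t) ∧
    y = trunc a b c e t) ?_ ⟨e, d, t, h, rfl, rfl⟩
  rintro _ _ ⟨_ | e, d, t, h, rfl, rfl⟩
  · rw [trunc_zero, trunc_zero]; exact .refl _
  obtain ⟨d, rfl⟩ : ∃ d', d = d' + 1 := ⟨d - 1, by omega⟩
  rcases t.cases with rfl | ⟨n, rfl⟩ | ⟨u, rfl⟩ | ⟨u, v, rfl⟩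
  · rw [trunc_star, trunc_star]; exact .refl _
  · rw [trunc_var, trunc_var]; exact .refl _
  · rw [trunc_lam, trunc_lam, trunc_lam]
    exact .lam ⟨_, _, _, Nat.sub_le_sub_right h _, rfl, rfl⟩
  · rw [trunc_app, trunc_app, trunc_app]
    exact .app ⟨_, _, _, Nat.sub_le_sub_right h _, rfl, rfl⟩
      ⟨_, _, _, Nat.sub_le_sub_right h _, rfl, rfl⟩

theorem trunc_eq_of_le {e d : ℕ} (h : e ≤ d) {s t : Raw}
    (hst : s.trunc a b c d = t.trunc a b c d) : s.trunc a b c e = t.trunc a b c e := by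
  rw [← trunc_trunc h s, hst, trunc_trunc h]

end Raw

/-! ### Terms -/

theorem later_iff {α β : Type*} (e : Bool) (X₀ X₁ : α → β → Prop) (x : α) (y : β) :
    later e X₀ X₁ x y ↔ (e = false → X₀ x y) ∧ (e = true → X₁ x y) := by
  cases e <;> simp [later]

namespace Term

variable {a b c : Bool}

theorem lam_inj {u v : Term a b c} (h : lam u = lam v) : u = v :=
  Subtype.ext (Raw.lam_inj (congrArg Subtype.val h))

theorem app_inj {u v u' v' : Term a b c} (h : app u v = app u' v') : u = u' ∧ v = v' :=
  (Raw.app_inj (congrArg Subtype.val h)).imp Subtype.ext Subtype.ext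

/-- Induction along the inductive premisses of the formation rules. -/
theorem induction {P : Term a b c → Prop} (var : ∀ n, P (var n))
    (lam : ∀ u, (a = false → P u) → P (lam u))
    (app : ∀ u v, (b = false → P u) → (c = false → P v) → P (app u v)) (t : Term a b c) : P t := by
  -- Membership is carried along with `P`, since coinductive premisses only provide membership.
  have key : termSet a b c ≤ {t | ∃ h : t ∈ termSet a b c, P ⟨t, h⟩} := by
    refine nuMu_le _ _ _ ?_
    have hl : ∀ (e : Bool) (s : Raw), s ∈ later e {t | ∃ h : t ∈ termSet a b c, P ⟨t, h⟩}
        (termSet a b c) → ∃ h : s ∈ termSet a b c, e = false → P ⟨s, h⟩ := by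
      intro e s hs
      cases e
      · exact ⟨hs.1, fun _ => hs.2⟩
      · exact ⟨hs, fun h => nomatch h⟩
    rintro s (n | h | ⟨h, h'⟩)
    · exact ⟨_, var n⟩
    · obtain ⟨h1, h2⟩ := hl _ _ h
      exact ⟨_, lam ⟨_, h1⟩ h2⟩
    · obtain ⟨h1, h2⟩ := hl _ _ h
      obtain ⟨h3, h4⟩ := hl _ _ h'
      exact ⟨_, app ⟨_, h1⟩ ⟨_, h3⟩ h2 h4⟩
  exact (key t.2).2

theorem cases (t : Term a b c) :
    (∃ n, t = var n) ∨ (∃ u, t = lam u) ∨ ∃ u v, t = app u v := by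
  refine t.induction (P := fun t => (∃ n, t = var n) ∨ (∃ u, t = lam u) ∨ ∃ u v, t = app u v)
    ?_ ?_ ?_
  · exact fun n => .inl ⟨n, rfl⟩
  · exact fun u _ => .inr (.inl ⟨u, rfl⟩)
  · exact fun u v _ _ => .inr (.inr ⟨u, v, rfl⟩)

/-! ### Renaming and substitution of terms -/

def rename (ρ : ℕ → ℕ) (t : Term a b c) : Term a b c := ⟨t.1.rename ρ, rename_mem t.2 ρ⟩

def subst (σ : ℕ → Term a b c) (t : Term a b c) : Term a b c :=
  ⟨t.1.subst fun n => (σ n).1, subst_mem t.2 _ fun n => (σ n).2⟩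

def up (σ : ℕ → Term a b c) : ℕ → Term a b c
  | 0 => var 0
  | n + 1 => (σ n).rename Nat.succ

theorem val_up (σ : ℕ → Term a b c) : (fun n => (up σ n).1) = Raw.up fun n => (σ n).1 := by
  funext n; cases n <;> rfl

theorem rename_var (ρ : ℕ → ℕ) (n : ℕ) : (var n : Term a b c).rename ρ = var (ρ n) :=
  Subtype.ext (InfLam.rename_var ρ n)

theorem rename_lam (ρ : ℕ → ℕ) (u : Term a b c) :
    (lam u).rename ρ = lam (u.rename (Raw.liftRen ρ)) :=
  Subtype.ext (InfLam.rename_lam ρ u.1)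

theorem rename_app (ρ : ℕ → ℕ) (u v : Term a b c) :
    (app u v).rename ρ = app (u.rename ρ) (v.rename ρ) :=
  Subtype.ext (InfLam.rename_app ρ u.1 v.1)

theorem subst_var (σ : ℕ → Term a b c) (n : ℕ) : (var n).subst σ = σ n :=
  Subtype.ext (InfLam.subst_var _ n)

theorem subst_lam (σ : ℕ → Term a b c) (u : Term a b c) :
    (lam u).subst σ = lam (u.subst (up σ)) :=
  Subtype.ext <| (InfLam.subst_lam _ u.1).trans <| congrArg (fun τ => Raw.lam (u.1.subst τ))
    (val_up σ).symm

theorem subst_app (σ : ℕ → Term a b c) (u v : Term a b c) :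
    (app u v).subst σ = app (u.subst σ) (v.subst σ) :=
  Subtype.ext (InfLam.subst_app _ u.1 v.1)

theorem rename_eq_subst (ρ : ℕ → ℕ) (t : Term a b c) :
    t.rename ρ = t.subst fun n => var (ρ n) :=
  Subtype.ext (Raw.rename_eq_subst ρ t.1)

theorem subst_inst (σ : ℕ → Term a b c) (u v : Term a b c) :
    (inst u v).subst σ = inst (u.subst (up σ)) (v.subst σ) :=
  Subtype.ext <| (Raw.subst_instSub _ u.1 v.1).trans <|
    congrArg (fun τ => (u.1.subst τ).subst (Raw.instSub (v.subst σ).1)) (val_up σ).symm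

/-- The substitution whose application is `inst · v`. -/
def instSub (v : Term a b c) : ℕ → Term a b c
  | 0 => v
  | n + 1 => var n

theorem inst_eq_subst (u v : Term a b c) : inst u v = u.subst (instSub v) := by
  refine Subtype.ext (congrArg (fun τ => u.1.subst τ) ?_)
  funext n; cases n <;> rfl

/-- `s` and `t` have the same truncation at depth `d`. -/
def Agree (d : ℕ) (s t : Term a b c) : Prop := s.1.trunc a b c d = t.1.trunc a b c d

theorem agree_zero (s t : Term a b c) : Agree 0 s t := by
  rw [Agree, Raw.trunc_zero, Raw.trunc_zero]

theorem Agree.mono {d e : ℕ} (h : e ≤ d) {s t : Term a b c} (hst : Agree d s t) : Agree e s t :=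
  Raw.trunc_eq_of_le h hst

theorem agree_lam {d : ℕ} {u u' : Term a b c} (h : Agree (d - a.toNat) u u') :
    Agree d (lam u) (lam u') := by
  rcases d with _ | d
  · exact agree_zero _ _
  · simp only [Agree, lam] at h ⊢
    rw [Raw.trunc_lam, Raw.trunc_lam, h]

theorem agree_app {d : ℕ} {u u' v v' : Term a b c} (h : Agree (d - b.toNat) u u')
    (h' : Agree (d - c.toNat) v v') : Agree d (app u v) (app u' v') := by
  rcases d with _ | d
  · exact agree_zero _ _
  · simp only [Agree, app] at h h' ⊢
    rw [Raw.trunc_app, Raw.trunc_app, h, h']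

theorem Agree.lam_inv {d : ℕ} {u u' : Term a b c} (h : Agree (d + 1) (lam u) (lam u')) :
    Agree (d + 1 - a.toNat) u u' := by
  simp only [Agree, Term.lam] at h ⊢
  rw [Raw.trunc_lam, Raw.trunc_lam] at h
  exact Raw.lam_inj h

theorem Agree.app_inv {d : ℕ} {u u' v v' : Term a b c}
    (h : Agree (d + 1) (app u v) (app u' v')) :
    Agree (d + 1 - b.toNat) u u' ∧ Agree (d + 1 - c.toNat) v v' := by
  simp only [Agree, Term.app] at h ⊢
  rw [Raw.trunc_app, Raw.trunc_app] at h
  exact Raw.app_inj h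

/-- Truncation at a positive depth keeps the root, so agreement at depth 1 determines the root
constructor. -/
theorem Agree.eq_var {n : ℕ} {s : Term a b c} (h : Agree 1 s (var n)) : s = var n := by
  rcases s.cases with ⟨m, rfl⟩ | ⟨u, rfl⟩ | ⟨u, v, rfl⟩ <;>
    simp only [Agree, Term.lam, Term.app, Term.var, Raw.trunc_var, Raw.trunc_lam, Raw.trunc_app]
      at h
  · rw [Raw.var_inj h]
  · exact absurd h.symm Raw.var_ne_lam
  · exact absurd h.symm Raw.var_ne_app

theorem Agree.eq_lam {s u : Term a b c} (h : Agree 1 s (Term.lam u)) :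
    ∃ u', s = Term.lam u' := by
  rcases s.cases with ⟨m, rfl⟩ | ⟨u, rfl⟩ | ⟨u, v, rfl⟩ <;>
    simp only [Agree, Term.lam, Term.app, Term.var, Raw.trunc_var, Raw.trunc_lam, Raw.trunc_app]
      at h
  · exact absurd h Raw.var_ne_lam
  · exact ⟨_, rfl⟩
  · exact absurd h.symm Raw.lam_ne_app

theorem Agree.eq_app {s u v : Term a b c} (h : Agree 1 s (Term.app u v)) :
    ∃ u' v', s = Term.app u' v' := by
  rcases s.cases with ⟨m, rfl⟩ | ⟨u, rfl⟩ | ⟨u, v, rfl⟩ <;>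
    simp only [Agree, Term.lam, Term.app, Term.var, Raw.trunc_var, Raw.trunc_lam, Raw.trunc_app]
      at h
  · exact absurd h Raw.var_ne_app
  · exact absurd h Raw.lam_ne_app
  · exact ⟨_, _, rfl⟩

/-- A term is determined by its truncations. -/
theorem eq_of_agree {s t : Term a b c} (h : ∀ d, Agree d s t) : s = t := by
  refine Subtype.ext (Raw.bisim (fun x y => ∃ s t : Term a b c, (∀ d, Agree d s t) ∧
    x = s.1 ∧ y = t.1) ?_ ⟨s, t, h, rfl, rfl⟩)
  rintro _ _ ⟨s, t, h, rfl, rfl⟩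
  -- A coinductive position costs one unit of depth, which is harmless when agreement holds at all
  -- depths.
  have hs : ∀ (e : Bool) (u v : Term a b c), (∀ d, Agree (d + 1 - e.toNat) u v) →
      ∀ d, Agree d u v := fun e u v h d => by
    refine (h d).mono ?_
    cases e <;> simp
  rcases t.cases with ⟨m, rfl⟩ | ⟨u, rfl⟩ | ⟨u, v, rfl⟩
  · rw [(h 1).eq_var]; exact .refl _
  · obtain ⟨u', rfl⟩ := (h 1).eq_lam
    exact .lam ⟨u', u, hs _ _ _ fun d => (h (d + 1)).lam_inv, rfl, rfl⟩
  · obtain ⟨u', v', rfl⟩ := (h 1).eq_app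
    exact .app ⟨u', u, hs _ _ _ fun d => (h (d + 1)).app_inv.1, rfl, rfl⟩
      ⟨v', v, hs _ _ _ fun d => (h (d + 1)).app_inv.2, rfl, rfl⟩

theorem dist_lt_of_agree {d : ℕ} {s t : Term a b c} (h : Agree d s t) {ε : ℝ}
    (hε : (1 / 2) ^ d < ε) : dist s t < ε := by
  refine lt_of_le_of_lt (csInf_le ⟨0, ?_⟩ ⟨d, rfl, h⟩) hε
  rintro _ ⟨d, rfl, -⟩
  positivity

/-- Strictness provides an element 2⁻ᵉ of the set below 2⁻ᵈ, without knowing that the infimum is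
attained; then e > d. -/
theorem agree_of_dist_lt {d : ℕ} {s t : Term a b c} (h : dist s t < (1 / 2) ^ d) :
    Agree d s t := by
  obtain ⟨_, ⟨e, rfl, he⟩, hlt⟩ := exists_lt_of_csInf_lt (by exact ⟨1, 0, by simp, agree_zero s t⟩) h
  refine Agree.mono (le_of_lt ?_) he
  exact (pow_lt_pow_iff_right_of_lt_one₀ (by norm_num) (by norm_num)).1 hlt

end Term

variable {a b c : Bool}

/-! ### Finite reductions -/

theorem BetaAt.subst {d : ℕ} {s t : Term a b c} (h : BetaAt d s t) :
    ∀ σ : ℕ → Term a b c, BetaAt d (s.subst σ) (t.subst σ) := by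
  induction h with
  | beta u v =>
    intro σ
    rw [Term.subst_app, Term.subst_lam, Term.subst_inst]
    exact .beta _ _
  | lam _ ih =>
    intro σ
    rw [Term.subst_lam, Term.subst_lam]
    exact .lam (ih _)
  | appL _ ih =>
    intro σ
    rw [Term.subst_app, Term.subst_app]
    exact .appL (ih _)
  | appR _ ih =>
    intro σ
    rw [Term.subst_app, Term.subst_app]
    exact .appR (ih _)

theorem BetaStar.subst {s t : Term a b c} (h : BetaStar s t) (σ : ℕ → Term a b c) :
    BetaStar (s.subst σ) (t.subst σ) :=
  Relation.ReflTransGen.lift _ (fun _ _ ⟨d, h⟩ => ⟨d, h.subst σ⟩) _ _ h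

theorem BetaStar.rename {s t : Term a b c} (h : BetaStar s t) (ρ : ℕ → ℕ) :
    BetaStar (s.rename ρ) (t.rename ρ) := by
  rw [Term.rename_eq_subst, Term.rename_eq_subst]
  exact h.subst _

theorem BetaStar.appL {u u' : Term a b c} (h : BetaStar u u') (v : Term a b c) :
    BetaStar (Term.app u v) (Term.app u' v) :=
  Relation.ReflTransGen.lift (fun u => Term.app u v) (fun _ _ ⟨_, h⟩ => ⟨_, h.appL⟩) _ _ h

/-! ### The standard presentation -/

namespace RedStd

theorem fold : StdRule RedStd RedStd = (RedStd : Term a b c → Term a b c → Prop) :=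
  nuMu_fold StdRule stdRule_mono

theorem of_var {s : Term a b c} {n : ℕ} (h : BetaStar s (Term.var n)) :
    RedStd s (Term.var n) := by
  rw [← fold]; exact .var h

theorem of_lam {s u u' : Term a b c} (h : BetaStar s (Term.lam u)) (hu : RedStd u u') :
    RedStd s (Term.lam u') := by
  rw [← fold]; exact .lam h (by rwa [later_self])

theorem of_app {s u u' v v' : Term a b c} (h : BetaStar s (Term.app u v)) (hu : RedStd u u')
    (hv : RedStd v v') : RedStd s (Term.app u' v') := by
  rw [← fold]; exact .app h (by rwa [later_self]) (by rwa [later_self])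

/-- Induction along the inductive premisses of the rules. -/
theorem induction {P : Term a b c → Term a b c → Prop}
    (var : ∀ s n, BetaStar s (Term.var n) → P s (Term.var n))
    (lam : ∀ s u u', BetaStar s (Term.lam u) → RedStd u u' → (a = false → P u u') →
      P s (Term.lam u'))
    (app : ∀ s u u' v v', BetaStar s (Term.app u v) → RedStd u u' → RedStd v v' →
      (b = false → P u u') → (c = false → P v v') → P s (Term.app u' v'))
    {s t : Term a b c} (h : RedStd s t) : P s t := by
  have key : RedStd ≤ fun s t : Term a b c => RedStd s t ∧ P s t := by
    refine nuMu_le _ _ _ ?_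
    have hl : ∀ (e : Bool) (u u' : Term a b c),
        later e (fun s t => RedStd s t ∧ P s t) RedStd u u' → RedStd u u' ∧ (e = false → P u u') := by
      intro e u u' h
      cases e
      · exact ⟨h.1, fun _ => h.2⟩
      · exact ⟨h, fun h => nomatch h⟩
    rintro s t (h | ⟨h, h1⟩ | ⟨h, h1, h2⟩)
    · exact ⟨of_var h, var _ _ h⟩
    · obtain ⟨h1, h1'⟩ := hl _ _ _ h1
      exact ⟨of_lam h h1, lam _ _ _ h h1 h1'⟩
    · obtain ⟨h1, h1'⟩ := hl _ _ _ h1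
      obtain ⟨h2, h2'⟩ := hl _ _ _ h2
      exact ⟨of_app h h1 h2, app _ _ _ _ _ h h1 h2 h1' h2'⟩
  exact (key _ _ h).2

/-- Coinduction. -/
theorem coinduction (C : Term a b c → Term a b c → Prop)
    (h : ∀ I : Term a b c → Term a b c → Prop,
      (∀ s n, BetaStar s (Term.var n) → I s (Term.var n)) →
      (∀ s u u', BetaStar s (Term.lam u) → (a = false → I u u') → (a = true → C u u') →
        I s (Term.lam u')) →
      (∀ s u u' v v', BetaStar s (Term.app u v) → (b = false → I u u') → (b = true → C u u') →
        (c = false → I v v') → (c = true → C v v') → I s (Term.app u' v')) →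
      ∀ s t, C s t → I s t) {s t : Term a b c} (hst : C s t) : RedStd s t := by
  refine le_nuMu StdRule stdRule_mono C (fun I hI => h I ?_ ?_ ?_) s t hst
  · exact fun s n h => hI _ _ (.var h)
  · exact fun s u u' h h0 h1 => hI _ _ (.lam h ((later_iff _ _ _ _ _).2 ⟨h0, h1⟩))
  · exact fun s u u' v v' h h0 h1 h2 h3 => hI _ _ (.app h ((later_iff _ _ _ _ _).2 ⟨h0, h1⟩)
      ((later_iff _ _ _ _ _).2 ⟨h2, h3⟩))

theorem var_inv {s : Term a b c} {n : ℕ} (h : RedStd s (Term.var n)) :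
    BetaStar s (Term.var n) := by
  rw [← fold] at h
  generalize ht : Term.var n = t at h
  rcases h with h | ⟨h, h1⟩ | ⟨h, h1, h2⟩
  · exact h
  · exact absurd (congrArg Subtype.val ht) Raw.var_ne_lam
  · exact absurd (congrArg Subtype.val ht) Raw.var_ne_app

theorem lam_inv {s u' : Term a b c} (h : RedStd s (Term.lam u')) :
    ∃ u, BetaStar s (Term.lam u) ∧ RedStd u u' := by
  rw [← fold] at h
  generalize ht : Term.lam u' = t at h
  rcases h with h | ⟨h, h1⟩ | ⟨h, h1, h2⟩
  · exact absurd (congrArg Subtype.val ht.symm) Raw.var_ne_lam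
  · rw [later_self, ← Term.lam_inj ht] at h1
    exact ⟨_, h, h1⟩
  · exact absurd (congrArg Subtype.val ht) Raw.lam_ne_app

theorem app_inv {s u' v' : Term a b c} (h : RedStd s (Term.app u' v')) :
    ∃ u v, BetaStar s (Term.app u v) ∧ RedStd u u' ∧ RedStd v v' := by
  rw [← fold] at h
  generalize ht : Term.app u' v' = t at h
  rcases h with h | ⟨h, h1⟩ | ⟨h, h1, h2⟩
  · exact absurd (congrArg Subtype.val ht.symm) Raw.var_ne_app
  · exact absurd (congrArg Subtype.val ht.symm) Raw.lam_ne_app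
  · rw [later_self, ← (Term.app_inj ht).1] at h1
    rw [later_self, ← (Term.app_inj ht).2] at h2
    exact ⟨_, _, h, h1, h2⟩

/-! ### Closure properties: reflexivity, substitution, transitivity -/

theorem head {s s' t : Term a b c} (h : BetaStar s s') (h' : RedStd s' t) : RedStd s t := by
  rw [← fold] at h' ⊢
  rcases h' with h1 | ⟨h1, h2⟩ | ⟨h1, h2, h3⟩
  · exact .var (h.trans h1)
  · exact .lam (h.trans h1) h2
  · exact .app (h.trans h1) h2 h3

protected theorem refl (s : Term a b c) : RedStd s s := by
  refine coinduction Eq (fun I hvar hlam happ => ?_) rfl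
  rintro s _ rfl
  -- The pattern of all the coinductions: an inner induction treats the inductive premisses, and the
  -- coinductive ones return to the candidate relation.
  refine s.induction (P := fun s => I s s) ?_ ?_ ?_
  · exact fun n => hvar _ _ .refl
  · exact fun u h => hlam _ _ _ .refl h fun _ => rfl
  · exact fun u v h h' => happ _ _ _ _ _ .refl h (fun _ => rfl) h' fun _ => rfl

theorem of_betaStar {s t : Term a b c} (h : BetaStar s t) : RedStd s t := head h (.refl t)

theorem rename {s t : Term a b c} (h : RedStd s t) (ρ : ℕ → ℕ) :
    RedStd (s.rename ρ) (t.rename ρ) := by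
  refine coinduction (fun x y => ∃ s t ρ, RedStd s t ∧ x = Term.rename ρ s ∧ y = Term.rename ρ t)
    (fun I hvar hlam happ => ?_) ⟨s, t, ρ, h, rfl, rfl⟩
  rintro _ _ ⟨s, t, ρ, h, rfl, rfl⟩
  refine h.induction (P := fun s t => ∀ ρ, I (s.rename ρ) (t.rename ρ)) ?_ ?_ ?_ ρ
  · intro s n h ρ
    have := h.rename ρ
    rw [Term.rename_var] at this ⊢
    exact hvar _ _ this
  · intro s u u' h h1 ih ρ
    have := h.rename ρ
    rw [Term.rename_lam] at this ⊢
    exact hlam _ _ _ this (fun e => ih e _) fun _ => ⟨_, _, _, h1, rfl, rfl⟩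
  · intro s u u' v v' h h1 h2 ih1 ih2 ρ
    have := h.rename ρ
    rw [Term.rename_app] at this ⊢
    exact happ _ _ _ _ _ this (fun e => ih1 e _) (fun _ => ⟨_, _, _, h1, rfl, rfl⟩)
      (fun e => ih2 e _) (fun _ => ⟨_, _, _, h2, rfl, rfl⟩)

theorem up {σ τ : ℕ → Term a b c} (h : ∀ n, RedStd (σ n) (τ n)) (n : ℕ) :
    RedStd (Term.up σ n) (Term.up τ n) := by
  cases n with
  | zero => exact .refl _
  | succ n => exact (h n).rename _

theorem subst {s t : Term a b c} (h : RedStd s t) {σ τ : ℕ → Term a b c}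
    (hστ : ∀ n, RedStd (σ n) (τ n)) : RedStd (s.subst σ) (t.subst τ) := by
  -- The first disjunct is needed at variables: there the derivation continues inside `σ n` and `τ
  -- n`, which are merely `RedStd`-related.
  refine coinduction (fun x y => RedStd x y ∨ ∃ s t σ τ, RedStd s t ∧
    (∀ n, RedStd (σ n) (τ n)) ∧ x = Term.subst σ s ∧ y = Term.subst τ t)
    (fun I hvar hlam happ => ?_) (.inr ⟨s, t, σ, τ, h, hστ, rfl, rfl⟩)
  have hI : ∀ s t, RedStd s t → I s t := fun s t h => by
    refine h.induction hvar ?_ ?_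
    · exact fun s u u' h h1 ih => hlam _ _ _ h ih fun _ => .inl h1
    · exact fun s u u' v v' h h1 h2 ih1 ih2 =>
        happ _ _ _ _ _ h ih1 (fun _ => .inl h1) ih2 fun _ => .inl h2
  rintro x y (h | ⟨s, t, σ, τ, h, hστ, rfl, rfl⟩)
  · exact hI _ _ h
  refine h.induction (P := fun s t => ∀ σ τ : ℕ → Term a b c, (∀ n, RedStd (σ n) (τ n)) →
    I (s.subst σ) (t.subst τ)) ?_ ?_ ?_ σ τ hστ
  · intro s n h σ τ hστ
    have := h.subst σ
    rw [Term.subst_var] at this ⊢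
    exact hI _ _ (head this (hστ n))
  · intro s u u' h h1 ih σ τ hστ
    have := h.subst σ
    rw [Term.subst_lam] at this ⊢
    exact hlam _ _ _ this (fun e => ih e _ _ (up hστ))
      fun _ => .inr ⟨_, _, _, _, h1, up hστ, rfl, rfl⟩
  · intro s u u' v v' h h1 h2 ih1 ih2 σ τ hστ
    have := h.subst σ
    rw [Term.subst_app] at this ⊢
    exact happ _ _ _ _ _ this (fun e => ih1 e _ _ hστ)
      (fun _ => .inr ⟨_, _, _, _, h1, hστ, rfl, rfl⟩) (fun e => ih2 e _ _ hστ)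
      (fun _ => .inr ⟨_, _, _, _, h2, hστ, rfl, rfl⟩)

theorem inst {u u' v v' : Term a b c} (hu : RedStd u u') (hv : RedStd v v') :
    RedStd (Term.inst u v) (Term.inst u' v') := by
  rw [Term.inst_eq_subst, Term.inst_eq_subst]
  refine hu.subst fun n => ?_
  cases n with
  | zero => exact hv
  | succ n => exact .refl _

/-- A β-step after an infinitary reduction can be absorbed. -/
theorem tail_betaAt {d : ℕ} {t t' : Term a b c} (ht : BetaAt d t t') :
    ∀ {s : Term a b c}, RedStd s t → RedStd s t' := by
  induction ht with
  | beta u' v' =>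
    intro s h
    obtain ⟨p, v, hs, hp, hv⟩ := h.app_inv
    obtain ⟨u, hp, hu⟩ := hp.lam_inv
    -- The source reduces finitely to a redex whose parts reduce infinitarily to those of the target
    -- redex. Contracting it gives one more finite step, and `inst` relates the contracta.
    exact head ((hs.trans (hp.appL v)).tail ⟨0, .beta u v⟩) (hu.inst hv)
  | lam _ ih =>
    intro s h
    obtain ⟨u, hs, hu⟩ := h.lam_inv
    exact of_lam hs (ih hu)
  | appL _ ih =>
    intro s h
    obtain ⟨u, v, hs, hu, hv⟩ := h.app_inv
    exact of_app hs (ih hu) hv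
  | appR _ ih =>
    intro s h
    obtain ⟨u, v, hs, hu, hv⟩ := h.app_inv
    exact of_app hs hu (ih hv)

theorem tail {s t t' : Term a b c} (h : RedStd s t) (ht : BetaStar t t') : RedStd s t' := by
  induction ht with
  | refl => exact h
  | tail _ h' ih => exact tail_betaAt h'.choose_spec ih

protected theorem trans {r s t : Term a b c} (h : RedStd r s) (h' : RedStd s t) : RedStd r t := by
  refine coinduction (fun x y => ∃ z, RedStd x z ∧ RedStd z y) (fun I hvar hlam happ => ?_)
    ⟨s, h, h'⟩
  rintro r t ⟨s, h, h'⟩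
  -- Induction on the second derivation: the finite reduction opening it is absorbed into the first
  -- one by `tail`, after which inversion matches the two roots.
  refine h'.induction (P := fun s t => ∀ r, RedStd r s → I r t) ?_ ?_ ?_ r h
  · exact fun s n hs r h => hvar _ _ (h.tail hs).var_inv
  · intro s u u' hs h1 ih r h
    obtain ⟨p, hr, hp⟩ := (h.tail hs).lam_inv
    exact hlam _ _ _ hr (fun e => ih e _ hp) fun _ => ⟨_, hp, h1⟩
  · intro s u u' v v' hs h1 h2 ih1 ih2 r h
    obtain ⟨p, q, hr, hp, hq⟩ := (h.tail hs).app_inv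
    exact happ _ _ _ _ _ hr (fun e => ih1 e _ hp) (fun _ => ⟨_, hp, h1⟩) (fun e => ih2 e _ hq)
      fun _ => ⟨_, hq, h2⟩

end RedStd

/-! ### The presentation with ordinal annotations -/

theorem redIG_eq (γ : Ordinal.{0}) :
    (RedIG γ : Term a b c → Term a b c → Prop) = Lift (RedI γ) (RedI γ) := by
  rw [RedIG]
  simp only [exists_prop]
  rfl

/-- No ordinal lies below 0, so a premiss sequence contains no auxiliary step and is a finite
reduction. -/
theorem splitLift_redIGBelow_zero :
    SplitLift (RedIGBelow 0) = (StdRule : (Term a b c → Term a b c → Prop) → _ → _) := by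
  funext X₀ X₁ s t
  refine propext ⟨?_, ?_⟩
  · rintro ⟨m, s', hs, h⟩
    have hs : BetaStar s s' := by
      rcases hs with h | ⟨_, ⟨δ, hδ, _⟩, _⟩
      · exact h
      · exact absurd hδ not_lt_zero
    rcases h with n | h | ⟨h, h'⟩
    · exact .var hs
    · exact .lam hs h
    · exact .app hs h h'
  · rintro (h | ⟨h, h1⟩ | ⟨h, h1, h2⟩)
    · exact ⟨0, _, .zero h, .var _⟩
    · exact ⟨0, _, .zero h, .lam h1⟩
    · exact ⟨0, _, .zero h, .app h1 h2⟩

theorem redOmega_eq_redStd : (RedOmega : Term a b c → Term a b c → Prop) = RedStd := by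
  unfold RedOmega RedI RedOf RedStd
  congr 1
  exact splitLift_redIGBelow_zero

theorem RedStd.redI {s t : Term a b c} (h : RedStd s t) (γ : Ordinal.{0}) : RedI γ s t := by
  refine le_nuMu (SplitLift (RedIGBelow γ)) (splitLift_mono _) RedStd (fun I hI => ?_) s t h
  intro s t h
  refine h.induction ?_ ?_ ?_
  · exact fun s n h => hI _ _ ⟨0, _, .zero h, .var n⟩
  · exact fun s u u' h h1 ih =>
      hI _ _ ⟨0, _, .zero h, .lam ((later_iff _ _ _ _ _).2 ⟨ih, fun _ => h1⟩)⟩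
  · exact fun s u u' v v' h h1 h2 ih1 ih2 =>
      hI _ _ ⟨0, _, .zero h, .app ((later_iff _ _ _ _ _).2 ⟨ih1, fun _ => h1⟩)
        ((later_iff _ _ _ _ _).2 ⟨ih2, fun _ => h2⟩)⟩

theorem SeqOf.redStd {G : Term a b c → Term a b c → Prop} (hG : ∀ s t, G s t → RedStd s t)
    {m : ℕ} {s t : Term a b c} (h : SeqOf G m s t) : RedStd s t := by
  induction h with
  | zero h => exact .of_betaStar h
  | succ h h1 _ ih => exact .head h ((hG _ _ h1).trans ih)

/-- If the auxiliary steps lie in `RedStd`, so does each premiss sequence, by transitivity. The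
candidate is `RedStd` followed by `RedOf G`: the sequence is absorbed on the left, and inversion
then exposes the root demanded by the lift rule. -/
theorem redStd_of_redOf {G : Term a b c → Term a b c → Prop} (hG : ∀ s t, G s t → RedStd s t)
    {s t : Term a b c} (h : RedOf G s t) : RedStd s t := by
  refine RedStd.coinduction (fun x y => ∃ z, RedStd x z ∧ RedOf G z y)
    (fun I hvar hlam happ => ?_) ⟨s, .refl s, h⟩
  have key : RedOf G ≤ fun s t => ∀ r, RedStd r s → I r t := by
    refine nuMu_le _ _ _ ?_
    rintro s t ⟨m, s', hs, h⟩ r hr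
    replace hr : RedStd r s' := hr.trans (hs.redStd hG)
    rcases h with n | h | ⟨h, h'⟩
    · exact hvar _ _ hr.var_inv
    · obtain ⟨p, hr, hp⟩ := hr.lam_inv
      have h := (later_iff _ _ _ _ _).1 h
      exact hlam _ _ _ hr (fun e => h.1 e _ hp) fun e => ⟨_, hp, h.2 e⟩
    · obtain ⟨p, q, hr, hp, hq⟩ := hr.app_inv
      have h := (later_iff _ _ _ _ _).1 h
      have h' := (later_iff _ _ _ _ _).1 h'
      exact happ _ _ _ _ _ hr (fun e => h.1 e _ hp) (fun e => ⟨_, hp, h.2 e⟩)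
        (fun e => h'.1 e _ hq) fun e => ⟨_, hq, h'.2 e⟩
  rintro r t ⟨s, hr, h⟩
  exact key _ _ h r hr

theorem redI_iff_redStd (γ : Ordinal.{0}) {s t : Term a b c} : RedI γ s t ↔ RedStd s t := by
  refine ⟨?_, fun h => h.redI γ⟩
  induction γ using WellFoundedLT.induction generalizing s t with
  | ind γ ih =>
    refine redStd_of_redOf ?_
    rintro s t ⟨δ, hδ, h⟩
    rw [redIG_eq] at h
    rcases h with n | h | ⟨h, h'⟩
    · exact .refl _
    · rw [later_self] at h
      exact .of_lam .refl (ih δ hδ h)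
    · rw [later_self] at h h'
      exact .of_app .refl (ih δ hδ h) (ih δ hδ h')

/-! ### From strongly converging sequences to the standard presentation -/

/-- A β-step at depth at least `N`. -/
def StepFrom (N : ℕ) (s t : Term a b c) : Prop := ∃ d, N ≤ d ∧ BetaAt d s t

/-- At most one β-step, at depth at least `N`. -/
def QuasiStep (N : ℕ) (s t : Term a b c) : Prop := s = t ∨ StepFrom N s t

theorem QuasiStep.mono {M N : ℕ} (h : M ≤ N) {s t : Term a b c} (hst : QuasiStep N s t) :
    QuasiStep M s t :=
  hst.imp_right fun ⟨d, hd, hst⟩ => ⟨d, h.trans hd, hst⟩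

theorem QuasiStep.lam_inv {N : ℕ} {u u' : Term a b c}
    (h : QuasiStep N (Term.lam u) (Term.lam u')) : QuasiStep (N - a.toNat) u u' := by
  rcases h with h | ⟨d, hd, h⟩
  · exact .inl (Term.lam_inj h)
  · generalize hs : Term.lam u = s, ht : Term.lam u' = t at h
    rcases h with _ | h | h | h
    · exact absurd (congrArg Subtype.val hs) Raw.lam_ne_app
    · rw [Term.lam_inj hs, Term.lam_inj ht]
      exact .inr ⟨_, by omega, h⟩
    · exact absurd (congrArg Subtype.val hs) Raw.lam_ne_app
    · exact absurd (congrArg Subtype.val hs) Raw.lam_ne_app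

/-- Positive depth excludes contraction at the root, whose contractum could itself be an
application. Abstractions need no such condition, not being redexes. -/
theorem QuasiStep.app_inv {N : ℕ} (hN : 1 ≤ N) {u u' v v' : Term a b c}
    (h : QuasiStep N (Term.app u v) (Term.app u' v')) :
    QuasiStep (N - b.toNat) u u' ∧ QuasiStep (N - c.toNat) v v' := by
  rcases h with h | ⟨d, hd, h⟩
  · exact ⟨.inl (Term.app_inj h).1, .inl (Term.app_inj h).2⟩
  · generalize hs : Term.app u v = s, ht : Term.app u' v' = t at h
    rcases h with _ | h | h | h
    · omega
    · exact absurd (congrArg Subtype.val hs.symm) Raw.lam_ne_app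
    · rw [(Term.app_inj hs).1, (Term.app_inj ht).1, (Term.app_inj hs).2, (Term.app_inj ht).2]
      exact ⟨.inr ⟨_, by omega, h⟩, .inl rfl⟩
    · rw [(Term.app_inj hs).1, (Term.app_inj ht).1, (Term.app_inj hs).2, (Term.app_inj ht).2]
      exact ⟨.inl rfl, .inr ⟨_, by omega, h⟩⟩

/-- A strongly converging sequence indexed by the interval `[α, γ]`, where steps may be void. -/
structure Converges (α γ : Ordinal.{0}) (s : Ordinal.{0} → Term a b c) : Prop where
  step : ∀ δ, α ≤ δ → δ < γ → QuasiStep 0 (s δ) (s (δ + 1))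
  limit : ∀ γ', α < γ' → γ' ≤ γ → Order.IsSuccLimit γ' → ∀ N : ℕ, ∃ δ₀ < γ', ∀ δ, α ≤ δ →
    δ₀ ≤ δ → δ < γ' → QuasiStep N (s δ) (s (δ + 1)) ∧ Term.Agree N (s δ) (s γ')

theorem IsStronglyConverging.converges {γ : Ordinal.{0}} {s : Ordinal.{0} → Term a b c}
    {d : Ordinal.{0} → ℕ} (h : IsStronglyConverging γ s d) : Converges 0 γ s where
  step δ _ hδ := .inr ⟨_, Nat.zero_le _, h.step δ hδ⟩
  limit γ' _ hγ hlim N := by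
    obtain ⟨δ₁, h1, h1'⟩ := h.tendsto_term γ' hγ hlim ((1 / 2) ^ N) (by positivity)
    obtain ⟨δ₂, h2, h2'⟩ := h.tendsto_depth γ' hγ hlim N
    refine ⟨max δ₁ δ₂, max_lt h1 h2, fun δ _ hδ hδ' => ⟨.inr ⟨_, ?_, h.step δ (hδ'.trans_le hγ)⟩,
      Term.agree_of_dist_lt (h1' δ ((le_max_left _ _).trans hδ) hδ')⟩⟩
    exact h2' δ ((le_max_right _ _).trans hδ) hδ'

namespace Converges

variable {α γ : Ordinal.{0}} {s : Ordinal.{0} → Term a b c}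

theorem restrict (h : Converges α γ s) {α' γ' : Ordinal.{0}} (hα : α ≤ α') (hγ : γ' ≤ γ) :
    Converges α' γ' s where
  step δ h1 h2 := h.step δ (hα.trans h1) (h2.trans_le hγ)
  limit β h1 h2 hβ N := by
    obtain ⟨δ₀, h3, h4⟩ := h.limit β (hα.trans_lt h1) (h2.trans hγ) hβ N
    exact ⟨δ₀, h3, fun δ h5 => h4 δ (hα.trans h5)⟩

/-- Passing to immediate subterms loses at most one unit of depth; the limit conditions survive
since they are required for every `N`. -/
theorem transfer (h : Converges α γ s) {u : Ordinal.{0} → Term a b c}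
    (hstep : ∀ N δ, α ≤ δ → δ < γ → QuasiStep N (s δ) (s (δ + 1)) →
      QuasiStep (N - 1) (u δ) (u (δ + 1)))
    (hagree : ∀ N δ δ', α ≤ δ → δ ≤ γ → α ≤ δ' → δ' ≤ γ → Term.Agree (N + 1) (s δ) (s δ') →
      Term.Agree N (u δ) (u δ')) : Converges α γ u where
  step δ h1 h2 := hstep 0 δ h1 h2 (h.step δ h1 h2)
  limit β h1 h2 hβ N := by
    obtain ⟨δ₀, h3, h4⟩ := h.limit β h1 h2 hβ (N + 1)
    refine ⟨δ₀, h3, fun δ h5 h6 h7 => ?_⟩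
    obtain ⟨h8, h9⟩ := h4 δ h5 h6 h7
    exact ⟨hstep (N + 1) δ h5 (h7.trans_le h2) h8,
      hagree N δ β h5 (h7.le.trans h2) h1.le h2 h9⟩

theorem of_lam (h : Converges α γ s) {u : Ordinal.{0} → Term a b c}
    (hu : ∀ δ, α ≤ δ → δ ≤ γ → s δ = Term.lam (u δ)) : Converges α γ u := by
  have ha := a.toNat_le
  refine h.transfer (fun N δ h1 h2 h3 => ?_) fun N δ δ' h1 h2 h3 h4 h5 => ?_
  · rw [hu δ h1 h2.le, hu (δ + 1) (h1.trans (Order.le_succ δ)) (Order.succ_le_of_lt h2)] at h3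
    exact h3.lam_inv.mono (by omega)
  · rw [hu δ h1 h2, hu δ' h3 h4] at h5
    exact h5.lam_inv.mono (by omega)

theorem of_app (h : Converges α γ s) {u v : Ordinal.{0} → Term a b c}
    (huv : ∀ δ, α ≤ δ → δ ≤ γ → s δ = Term.app (u δ) (v δ))
    (h1 : ∀ δ, α ≤ δ → δ < γ → QuasiStep 1 (s δ) (s (δ + 1))) :
    Converges α γ u ∧ Converges α γ v := by
  have hb := b.toNat_le
  have hc := c.toNat_le
  have hstep : ∀ N δ, α ≤ δ → δ < γ → QuasiStep N (s δ) (s (δ + 1)) →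
      QuasiStep (N - 1) (u δ) (u (δ + 1)) ∧ QuasiStep (N - 1) (v δ) (v (δ + 1)) := by
    intro N δ h2 h3 h4
    -- For `N = 0` the given step could be a root contraction; `h1` raises its depth to 1.
    have h5 : QuasiStep (max N 1) (s δ) (s (δ + 1)) := by
      rcases N with _ | N
      · exact h1 δ h2 h3
      · exact h4.mono (by omega)
    rw [huv δ h2 h3.le, huv (δ + 1) (h2.trans (Order.le_succ δ)) (Order.succ_le_of_lt h3)] at h5
    have h6 := h5.app_inv (le_max_right _ _)
    exact ⟨h6.1.mono (by omega), h6.2.mono (by omega)⟩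
  have hagree : ∀ N δ δ', α ≤ δ → δ ≤ γ → α ≤ δ' → δ' ≤ γ → Term.Agree (N + 1) (s δ) (s δ') →
      Term.Agree N (u δ) (u δ') ∧ Term.Agree N (v δ) (v δ') := by
    intro N δ δ' h1 h2 h3 h4 h5
    rw [huv δ h1 h2, huv δ' h3 h4] at h5
    exact ⟨h5.app_inv.1.mono (by omega), h5.app_inv.2.mono (by omega)⟩
  exact ⟨h.transfer (fun N δ h2 h3 h4 => (hstep N δ h2 h3 h4).1)
      fun N δ δ' h2 h3 h4 h5 h6 => (hagree N δ δ' h2 h3 h4 h5 h6).1,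
    h.transfer (fun N δ h2 h3 h4 => (hstep N δ h2 h3 h4).2)
      fun N δ δ' h2 h3 h4 h5 h6 => (hagree N δ δ' h2 h3 h4 h5 h6).2⟩

/-- All the terms indexed by `[α, γ)` agree with the last one at depth `1`, and all the steps take
place at depth at least `1`. -/
def Stable (α γ : Ordinal.{0}) (s : Ordinal.{0} → Term a b c) : Prop :=
  ∀ δ, α ≤ δ → δ < γ → QuasiStep 1 (s δ) (s (δ + 1)) ∧ Term.Agree 1 (s δ) (s γ)

theorem Stable.agree (h : Stable α γ s) {δ : Ordinal.{0}} (h1 : α ≤ δ) (h2 : δ ≤ γ) :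
    Term.Agree 1 (s δ) (s γ) := by
  rcases h2.lt_or_eq with h2 | rfl
  · exact (h δ h1 h2).2
  · exact rfl

theorem Stable.exists_lam (h : Stable α γ s) {u' : Term a b c} (hγ : s γ = Term.lam u') :
    ∃ u : Ordinal.{0} → Term a b c, ∀ δ, α ≤ δ → δ ≤ γ → s δ = Term.lam (u δ) := by
  have : Nonempty (Term a b c) := ⟨Term.var 0⟩
  have key : ∀ δ, α ≤ δ → δ ≤ γ → ∃ u, s δ = Term.lam u := fun δ h1 h2 =>
    Term.Agree.eq_lam (u := u') (by rw [← hγ]; exact h.agree h1 h2)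
  choose! u hu using key
  exact ⟨u, hu⟩

theorem Stable.exists_app (h : Stable α γ s) {u' v' : Term a b c} (hγ : s γ = Term.app u' v') :
    ∃ u v : Ordinal.{0} → Term a b c, ∀ δ, α ≤ δ → δ ≤ γ → s δ = Term.app (u δ) (v δ) := by
  have : Nonempty (Term a b c) := ⟨Term.var 0⟩
  have key : ∀ δ, α ≤ δ → δ ≤ γ → ∃ u v, s δ = Term.app u v := fun δ h1 h2 =>
    Term.Agree.eq_app (u := u') (v := v') (by rw [← hγ]; exact h.agree h1 h2)
  choose! u v huv using key
  exact ⟨u, v, huv⟩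

/-- Stability descends only into inductive positions, where depth does not drop. -/
theorem Stable.lam_inv (h : Stable α γ s) {u : Ordinal.{0} → Term a b c}
    (hu : ∀ δ, α ≤ δ → δ ≤ γ → s δ = Term.lam (u δ)) (ha : a = false) : Stable α γ u := by
  intro δ h1 h2
  obtain ⟨h3, h4⟩ := h δ h1 h2
  rw [hu δ h1 h2.le] at h3 h4
  rw [hu (δ + 1) (h1.trans (Order.le_succ δ)) (Order.succ_le_of_lt h2)] at h3
  rw [hu γ (h1.trans h2.le) le_rfl] at h4
  have h5 : 1 ≤ 1 - a.toNat := by simp [ha]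
  exact ⟨h3.lam_inv.mono h5, h4.lam_inv.mono h5⟩

theorem Stable.app_inv (h : Stable α γ s) {u v : Ordinal.{0} → Term a b c}
    (huv : ∀ δ, α ≤ δ → δ ≤ γ → s δ = Term.app (u δ) (v δ)) :
    (b = false → Stable α γ u) ∧ (c = false → Stable α γ v) := by
  have key : ∀ δ, α ≤ δ → δ < γ →
      (QuasiStep (1 - b.toNat) (u δ) (u (δ + 1)) ∧ QuasiStep (1 - c.toNat) (v δ) (v (δ + 1))) ∧
      Term.Agree (1 - b.toNat) (u δ) (u γ) ∧ Term.Agree (1 - c.toNat) (v δ) (v γ) := by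
    intro δ h1 h2
    obtain ⟨h3, h4⟩ := h δ h1 h2
    rw [huv δ h1 h2.le] at h3 h4
    rw [huv (δ + 1) (h1.trans (Order.le_succ δ)) (Order.succ_le_of_lt h2)] at h3
    rw [huv γ (h1.trans h2.le) le_rfl] at h4
    exact ⟨h3.app_inv le_rfl, h4.app_inv⟩
  refine ⟨fun e δ h1 h2 => ?_, fun e δ h1 h2 => ?_⟩
  · obtain ⟨⟨h3, -⟩, h4, -⟩ := key δ h1 h2
    have h5 : 1 ≤ 1 - b.toNat := by simp [e]
    exact ⟨h3.mono h5, h4.mono h5⟩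
  · obtain ⟨⟨-, h3⟩, -, h4⟩ := key δ h1 h2
    have h5 : 1 ≤ 1 - c.toNat := by simp [e]
    exact ⟨h3.mono h5, h4.mono h5⟩

theorem redStd_limit (hγ : Order.IsSuccLimit γ)
    (ih : ∀ γ' < γ, ∀ α (s : Ordinal.{0} → Term a b c), α ≤ γ' → Converges α γ' s →
      RedStd (s α) (s γ')) (hαγ : α < γ) (h : Converges α γ s) : RedStd (s α) (s γ) := by
  -- The endpoint `γ` stays fixed: sequences of subterms are indexed by the same interval, so `ih`
  -- remains applicable at every coinductive unfolding.
  refine RedStd.coinduction (fun p q => ∃ α s, α < γ ∧ Converges α γ s ∧ RedStd p (s α) ∧ s γ = q)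
    (fun I hvar hlam happ => ?_) ⟨α, s, hαγ, h, .refl _, rfl⟩
  -- For stable sequences, induction on the limit term: stability passes to the inductive subterms,
  -- while the coinductive ones rejoin the candidate, which does not ask for it.
  have key : ∀ q p : Term a b c, ∀ α s, α < γ → Converges α γ s → Stable α γ s → RedStd p (s α) →
      s γ = q → I p q := by
    intro q
    refine q.induction (P := fun q => ∀ p : Term a b c, ∀ α s, α < γ → Converges α γ s →
      Stable α γ s → RedStd p (s α) → s γ = q → I p q) ?_ ?_ ?_
    · intro n p α s hα h hs hp hq
      have h1 := hs.agree le_rfl hα.le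
      rw [hq] at h1
      rw [h1.eq_var] at hp
      exact hvar _ _ hp.var_inv
    · intro u' ihu p α s hα h hs hp hq
      obtain ⟨u, hu⟩ := hs.exists_lam hq
      obtain rfl : u γ = u' := Term.lam_inj ((hu γ hα.le le_rfl).symm.trans hq)
      rw [hu α le_rfl hα.le] at hp
      obtain ⟨p', hpp', hp'⟩ := hp.lam_inv
      exact hlam _ _ _ hpp' (fun e => ihu e p' α u hα (h.of_lam hu) (hs.lam_inv hu e) hp' rfl)
        fun _ => ⟨α, u, hα, h.of_lam hu, hp', rfl⟩
    · intro u' v' ihu ihv p α s hα h hs hp hq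
      obtain ⟨u, v, huv⟩ := hs.exists_app hq
      obtain ⟨rfl, rfl⟩ : u γ = u' ∧ v γ = v' :=
        Term.app_inj ((huv γ hα.le le_rfl).symm.trans hq)
      rw [huv α le_rfl hα.le] at hp
      obtain ⟨p', q', hpp', hp', hq'⟩ := hp.app_inv
      obtain ⟨hu, hv⟩ := h.of_app huv fun δ h1 h2 => (hs δ h1 h2).1
      obtain ⟨hsu, hsv⟩ := hs.app_inv huv
      exact happ _ _ _ _ _ hpp' (fun e => ihu e p' α u hα hu (hsu e) hp' rfl)
        (fun _ => ⟨α, u, hα, hu, hp', rfl⟩) (fun e => ihv e q' α v hα hv (hsv e) hq' rfl)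
        fun _ => ⟨α, v, hα, hv, hq', rfl⟩
  rintro p q ⟨α, s, hα, h, hp, hq⟩
  -- Convergence at depth 1 makes the sequence stable from `max α δ₀` on; the segment before it is
  -- shorter than `γ`, and is absorbed by `ih` and transitivity.
  obtain ⟨δ₀, h1, h2⟩ := h.limit γ hα le_rfl hγ 1
  have hmax : max α δ₀ < γ := max_lt hα h1
  refine key q p (max α δ₀) s hmax (h.restrict (le_max_left _ _) le_rfl)
    (fun δ h3 h4 => h2 δ ((le_max_left _ _).trans h3) ((le_max_right _ _).trans h3) h4)
    (hp.trans ?_) hq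
  exact ih _ hmax α s (le_max_left _ _) (h.restrict le_rfl hmax.le)

theorem redStd (hαγ : α ≤ γ) (h : Converges α γ s) : RedStd (s α) (s γ) := by
  induction γ using WellFoundedLT.induction generalizing α s with
  | ind γ ih =>
    rcases hαγ.eq_or_lt with rfl | hαγ
    · exact .refl _
    rcases Ordinal.zero_or_succ_or_isSuccLimit γ with rfl | ⟨δ, rfl⟩ | hγ
    · exact absurd hαγ not_lt_zero
    · have hδ : α ≤ δ := Order.le_of_lt_succ hαγ
      have h1 := ih δ (Order.lt_succ δ) hδ (h.restrict le_rfl (Order.le_succ δ))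
      rcases h.step δ hδ (Order.lt_succ δ) with h2 | ⟨d, -, h2⟩
      · rw [h2] at h1
        exact h1
      · exact RedStd.tail_betaAt h2 h1
    · exact redStd_limit hγ (fun γ' h1 α s h2 h3 => ih γ' h1 h2 h3) hαγ h

end Converges

theorem RedInf.redStd {s t : Term a b c} (h : RedInf s t) : RedStd s t := by
  obtain ⟨γ, r, d, h, rfl, rfl⟩ := h
  exact h.converges.redStd zero_le

/-! ### From the standard presentation to strongly converging sequences -/

theorem BetaAt.agree {d : ℕ} {s t : Term a b c} (h : BetaAt d s t) : Term.Agree d s t := by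
  induction h with
  | beta u v => exact Term.agree_zero _ _
  | lam _ ih => exact Term.agree_lam (by rwa [Nat.add_sub_cancel])
  | appL _ ih => exact Term.agree_app (by rwa [Nat.add_sub_cancel]) rfl
  | appR _ ih => exact Term.agree_app rfl (by rwa [Nat.add_sub_cancel])

theorem StepFrom.agree {N : ℕ} {s t : Term a b c} (h : StepFrom N s t) : Term.Agree N s t := by
  obtain ⟨d, hd, h⟩ := h
  exact h.agree.mono hd

theorem StepFrom.mono {M N : ℕ} (h : M ≤ N) {s t : Term a b c} (hst : StepFrom N s t) :
    StepFrom M s t := by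
  obtain ⟨d, hd, hst⟩ := hst
  exact ⟨d, h.trans hd, hst⟩

theorem stepFrom_zero_star {s t : Term a b c} (h : BetaStar s t) :
    Relation.ReflTransGen (StepFrom 0) s t :=
  Relation.ReflTransGen.mono (fun _ _ ⟨d, h⟩ => ⟨d, Nat.zero_le d, h⟩) _ _ h

/-- `RedFrom d s t`: `t` is obtained from `s` by infinitary reductions of subterms at depth `d`. -/
inductive RedFrom : ℕ → Term a b c → Term a b c → Prop
  | zero {s t : Term a b c} : RedStd s t → RedFrom 0 s t
  | var (d n : ℕ) : RedFrom (d + 1) (Term.var n) (Term.var n)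
  | lam {d : ℕ} {u u' : Term a b c} : RedFrom (d + 1 - a.toNat) u u' →
      RedFrom (d + 1) (Term.lam u) (Term.lam u')
  | app {d : ℕ} {u u' v v' : Term a b c} : RedFrom (d + 1 - b.toNat) u u' →
      RedFrom (d + 1 - c.toNat) v v' → RedFrom (d + 1) (Term.app u v) (Term.app u' v')

theorem RedFrom.agree {d : ℕ} {s t : Term a b c} (h : RedFrom d s t) : Term.Agree d s t := by
  induction h with
  | zero => exact Term.agree_zero _ _
  | var => exact rfl
  | lam _ ih => exact Term.agree_lam ih
  | app _ _ ih ih' => exact Term.agree_app ih ih'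

theorem stepFrom_star_lam {N : ℕ} {u u' : Term a b c}
    (h : Relation.ReflTransGen (StepFrom (N - a.toNat)) u u') :
    Relation.ReflTransGen (StepFrom N) (Term.lam u) (Term.lam u') :=
  Relation.ReflTransGen.lift Term.lam (fun _ _ ⟨_, hd, h⟩ => ⟨_, by omega, h.lam⟩) _ _ h

theorem stepFrom_star_app {N : ℕ} {u u' v v' : Term a b c}
    (hu : Relation.ReflTransGen (StepFrom (N - b.toNat)) u u')
    (hv : Relation.ReflTransGen (StepFrom (N - c.toNat)) v v') :
    Relation.ReflTransGen (StepFrom N) (Term.app u v) (Term.app u' v') :=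
  .trans (Relation.ReflTransGen.lift (fun u => Term.app u v)
      (fun _ _ ⟨_, hd, h⟩ => ⟨_, by omega, h.appL⟩) _ _ hu)
    (Relation.ReflTransGen.lift (fun v => Term.app u' v)
      (fun _ _ ⟨_, hd, h⟩ => ⟨_, by omega, h.appR⟩) _ _ hv)

/-- Down to its coinductive premisses a derivation is wellfounded, so by induction its finite
reductions there combine into one; what remains sits below coinductive premisses, at depth 1. -/
theorem RedStd.exists_redFrom_one {s t : Term a b c} (h : RedStd s t) :
    ∃ s', Relation.ReflTransGen (StepFrom 0) s s' ∧ RedFrom 1 s' t := by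
  have hl : ∀ (e : Bool) (u u' : Term a b c), RedStd u u' →
      (e = false → ∃ s', Relation.ReflTransGen (StepFrom 0) u s' ∧ RedFrom 1 s' u') →
      ∃ s', Relation.ReflTransGen (StepFrom 0) u s' ∧ RedFrom (0 + 1 - e.toNat) s' u' := by
    intro e u u' h ih
    cases e
    · exact ih rfl
    · exact ⟨u, .refl, .zero h⟩
  refine h.induction (P := fun s t => ∃ s', Relation.ReflTransGen (StepFrom 0) s s' ∧
    RedFrom 1 s' t) ?_ ?_ ?_
  · exact fun s n h => ⟨_, stepFrom_zero_star h, .var 0 n⟩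
  · intro s u u' h h1 ih
    obtain ⟨w, hw, hw'⟩ := hl _ _ _ h1 ih
    exact ⟨_, (stepFrom_zero_star h).trans (stepFrom_star_lam (by rwa [Nat.zero_sub])), .lam hw'⟩
  · intro s u u' v v' h h1 h2 ih1 ih2
    obtain ⟨w, hw, hw'⟩ := hl _ _ _ h1 ih1
    obtain ⟨z, hz, hz'⟩ := hl _ _ _ h2 ih2
    exact ⟨_, (stepFrom_zero_star h).trans (stepFrom_star_app (by rwa [Nat.zero_sub])
      (by rwa [Nat.zero_sub])), .app hw' hz'⟩

theorem RedFrom.exists_succ {d : ℕ} {s t : Term a b c} (h : RedFrom d s t) :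
    ∃ s', Relation.ReflTransGen (StepFrom d) s s' ∧ RedFrom (d + 1) s' t := by
  have hs : ∀ (e : Bool) (d : ℕ), d + 1 - e.toNat + 1 = d + 1 + 1 - e.toNat := fun e d => by
    have := e.toNat_le
    omega
  induction h with
  | zero h => exact h.exists_redFrom_one
  | var d n => exact ⟨_, .refl, .var _ n⟩
  | lam _ ih =>
    obtain ⟨u, h1, h2⟩ := ih
    rw [hs] at h2
    exact ⟨_, stepFrom_star_lam h1, .lam h2⟩
  | app _ _ ih ih' =>
    obtain ⟨u, h1, h2⟩ := ih
    obtain ⟨v, h3, h4⟩ := ih'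
    rw [hs] at h2 h4
    exact ⟨_, stepFrom_star_app h1 h3, .app h2 h4⟩

theorem RedFrom.exists_add {d : ℕ} {s t : Term a b c} (h : RedFrom d s t) (k : ℕ) :
    ∃ s', Relation.ReflTransGen (StepFrom d) s s' ∧ RedFrom (d + k) s' t := by
  induction k with
  | zero => exact ⟨s, .refl, h⟩
  | succ k ih =>
    obtain ⟨s', h1, h2⟩ := ih
    obtain ⟨s'', h3, h4⟩ := h2.exists_succ
    exact ⟨s'', h1.trans
      (Relation.ReflTransGen.mono (fun _ _ => StepFrom.mono (Nat.le_add_right d k)) _ _ h3), h4⟩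

/-- Distinct terms disagree at some depth `e`. Unwinding beyond `e` must involve a step, for
otherwise the source would agree with `t` there. -/
theorem RedFrom.exists_transGen {d : ℕ} {s t : Term a b c} (h : RedFrom d s t) (hne : s ≠ t) :
    ∃ d' > d, ∃ s', Relation.TransGen (StepFrom d) s s' ∧ RedFrom d' s' t := by
  obtain ⟨e, he⟩ : ∃ e, ¬ Term.Agree e s t := by
    by_contra! hall
    exact hne (Term.eq_of_agree hall)
  obtain ⟨s', h1, h2⟩ := h.exists_add (e + 1)
  -- The extra 1 makes the new depth exceed `d` strictly.
  refine ⟨d + (e + 1), by omega, s', ?_, h2⟩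
  rcases Relation.reflTransGen_iff_eq_or_transGen.1 h1 with rfl | h1
  · exact absurd (h2.agree.mono (by omega)) he
  · exact h1

/-- `Pending t d k r`: after `k` steps at depth at least `d`, the term `r` is turned into a term
which differs from `t` only at depths greater than `d`. -/
def Pending (t : Term a b c) (d : ℕ) : ℕ → Term a b c → Prop
  | 0, r => ∃ d' > d, RedFrom d' r t
  | k + 1, r => ∃ r', StepFrom d r r' ∧ Pending t d k r'

theorem Pending.agree {t : Term a b c} {d k : ℕ} {r : Term a b c} (h : Pending t d k r) :
    Term.Agree d r t := by
  induction k generalizing r with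
  | zero =>
    obtain ⟨d', hd, h⟩ := h
    exact h.agree.mono (le_of_lt hd)
  | succ k ih =>
    obtain ⟨r', h1, h2⟩ := h
    exact h1.agree.trans (ih h2)

theorem RedFrom.exists_pending {d : ℕ} {s t : Term a b c} (h : RedFrom d s t) (hne : s ≠ t) :
    ∃ k, Pending t d (k + 1) s := by
  obtain ⟨d', hd, s', h1, h2⟩ := h.exists_transGen hne
  clear h hne
  induction h1 using Relation.TransGen.head_induction_on with
  | single h1 => exact ⟨0, _, h1, d', hd, h2⟩
  | head h1 _ ih =>
    obtain ⟨k, hk⟩ := ih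
    exact ⟨k + 1, _, h1, hk⟩

/-! ### Assembling strongly converging sequences -/

theorem RedInf.refl (s : Term a b c) : RedInf s s := by
  refine ⟨0, fun _ => s, fun _ => 0, ⟨fun δ h => absurd h not_lt_zero, fun γ' h h' => ?_,
    fun γ' h h' => ?_⟩, rfl, rfl⟩ <;>
  exact absurd (h'.bot_lt.trans_le h) (lt_irrefl _)

theorem RedInf.tail {s t t' : Term a b c} (h : RedInf s t) (ht : Beta t t') : RedInf s t' := by
  obtain ⟨γ, r, d, h, rfl, rfl⟩ := h
  obtain ⟨e, ht⟩ := ht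
  let r' : Ordinal.{0} → Term a b c := fun δ => if δ ≤ γ then r δ else t'
  let d' : Ordinal.{0} → ℕ := fun δ => if δ < γ then d δ else e
  have hr : ∀ δ ≤ γ, r' δ = r δ := fun δ h => if_pos h
  have hd : ∀ δ < γ, d' δ = d δ := fun δ h => if_pos h
  have hrs : r' (γ + 1) = t' := if_neg (not_le_of_gt (Order.lt_succ γ))
  -- Appending a step creates no new limit ordinal, so the convergence conditions are inherited.
  have hlim : ∀ γ' ≤ γ + 1, Order.IsSuccLimit γ' → γ' ≤ γ := fun γ' h1 h2 =>
    Order.le_of_lt_succ (lt_of_le_of_ne h1 fun h3 =>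
      Order.not_isSuccPrelimit_succ γ (by rw [h3] at h2; exact h2.isSuccPrelimit))
  refine ⟨γ + 1, r', d', ⟨fun δ h1 => ?_, fun γ' h1 h2 ε hε => ?_, fun γ' h1 h2 N => ?_⟩,
    hr 0 zero_le, hrs⟩
  · rcases (Order.le_of_lt_succ h1).lt_or_eq with h1 | rfl
    · rw [hr δ h1.le, hr (δ + 1) (Order.succ_le_of_lt h1), hd δ h1]
      exact h.step δ h1
    · rw [hr δ le_rfl, hrs, show d' δ = e from if_neg (lt_irrefl δ)]
      exact ht
  · have h3 := hlim γ' h1 h2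
    obtain ⟨δ₀, h4, h5⟩ := h.tendsto_term γ' h3 h2 ε hε
    refine ⟨δ₀, h4, fun δ h6 h7 => ?_⟩
    rw [hr δ (h7.le.trans h3), hr γ' h3]
    exact h5 δ h6 h7
  · have h3 := hlim γ' h1 h2
    obtain ⟨δ₀, h4, h5⟩ := h.tendsto_depth γ' h3 h2 N
    refine ⟨δ₀, h4, fun δ h6 h7 => ?_⟩
    rw [hd δ (h7.trans_le h3)]
    exact h5 δ h6 h7

theorem BetaStar.redInf {s t : Term a b c} (h : BetaStar s t) : RedInf s t := by
  induction h with
  | refl => exact .refl _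
  | tail _ h ih => exact ih.tail h

/-- A strongly converging sequence of length `ω`. -/
theorem redInf_of_nat_seq (f : ℕ → Term a b c) (e : ℕ → ℕ) (t : Term a b c)
    (hstep : ∀ n, BetaAt (e n) (f n) (f (n + 1)))
    (hlim : ∀ N, ∃ n₀, ∀ n ≥ n₀, N ≤ e n ∧ Term.Agree N (f n) t) : RedInf (f 0) t := by
  -- A finite ordinal is decoded as a natural number through its cardinality.
  let r : Ordinal.{0} → Term a b c := fun δ =>
    if δ < Ordinal.omega0 then f (Cardinal.toNat δ.card) else t
  let d : Ordinal.{0} → ℕ := fun δ => e (Cardinal.toNat δ.card)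
  have hr : ∀ n : ℕ, r n = f n := fun n => by simp [r, Ordinal.natCast_lt_omega0]
  have hrω : r Ordinal.omega0 = t := if_neg (lt_irrefl _)
  have hd : ∀ n : ℕ, d n = e n := fun n => by simp [d]
  have hγ : ∀ γ' ≤ Ordinal.omega0, Order.IsSuccLimit γ' → γ' = Ordinal.omega0 := fun γ' h1 h2 =>
    le_antisymm h1 (Ordinal.omega0_le_of_isSuccLimit h2)
  refine ⟨Ordinal.omega0, r, d, ⟨fun δ h1 => ?_, fun γ' h1 h2 ε hε => ?_, fun γ' h1 h2 N => ?_⟩,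
    by simpa using hr 0, hrω⟩
  · obtain ⟨n, rfl⟩ := Ordinal.lt_omega0.1 h1
    rw [hr, hd, ← Nat.cast_succ, hr]
    exact hstep n
  · rw [hγ γ' h1 h2, hrω]
    obtain ⟨N, hN⟩ := exists_pow_lt_of_lt_one hε (by norm_num : (1 / 2 : ℝ) < 1)
    obtain ⟨n₀, h3⟩ := hlim N
    refine ⟨n₀, Ordinal.natCast_lt_omega0 n₀, fun δ h4 h5 => ?_⟩
    obtain ⟨n, rfl⟩ := Ordinal.lt_omega0.1 h5
    rw [hr]
    exact Term.dist_lt_of_agree (h3 n (Nat.cast_le.1 h4)).2 hN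
  · rw [hγ γ' h1 h2]
    obtain ⟨n₀, h3⟩ := hlim N
    refine ⟨n₀, Ordinal.natCast_lt_omega0 n₀, fun δ h4 h5 => ?_⟩
    obtain ⟨n, rfl⟩ := Ordinal.lt_omega0.1 h5
    rw [hd]
    exact (h3 n (Nat.cast_le.1 h4)).1

/-- The first step of a pending reduction to a term which is not reached in finitely many steps. -/
theorem Pending.next {t r : Term a b c} {d k : ℕ} (h : Pending t d (k + 1) r)
    (hne : ¬ BetaStar r t) : ∃ d' k' r', StepFrom d r r' ∧ Pending t d' (k' + 1) r' ∧
      ¬ BetaStar r' t ∧ (d' = d ∧ k' < k ∨ d < d') := by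
  obtain ⟨r', h1, h2⟩ := h
  have hne' : ¬ BetaStar r' t := fun h3 => hne (.head ⟨_, h1.choose_spec.2⟩ h3)
  rcases k with _ | k
  · obtain ⟨d', hd, h2⟩ := h2
    obtain ⟨k', hk⟩ := h2.exists_pending fun h3 => hne' (h3 ▸ .refl)
    exact ⟨d', k', r', h1, hk, hne', .inr hd⟩
  · exact ⟨d, k, r', h1, h2, hne', .inl ⟨rfl, Nat.lt_succ_self k⟩⟩

theorem RedStd.redInf {s t : Term a b c} (h : RedStd s t) : RedInf s t := by
  by_cases hst : BetaStar s t
  · exact hst.redInf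
  -- Since `t` is not reached in finitely many steps, every state has a successor, and iteration
  -- yields a sequence of length exactly ω. Each step either raises the depth or keeps it and lowers
  -- the counter of remaining steps.
  let S : Type := {x : ℕ × ℕ × Term a b c // Pending t x.1 (x.2.1 + 1) x.2.2 ∧ ¬ BetaStar x.2.2 t}
  have hnext : ∀ x : S, ∃ y : S, StepFrom x.1.1 x.1.2.2 y.1.2.2 ∧
      (y.1.1 = x.1.1 ∧ y.1.2.1 < x.1.2.1 ∨ x.1.1 < y.1.1) := by
    rintro ⟨⟨d, k, r⟩, h1, h2⟩
    obtain ⟨d', k', r', h3, h4, h5, h6⟩ := h1.next h2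
    exact ⟨⟨⟨d', k', r'⟩, h4, h5⟩, h3, h6⟩
  choose next hstep hlex using hnext
  obtain ⟨k₀, hk₀⟩ := (RedFrom.zero h).exists_pending fun h3 => hst (h3 ▸ .refl)
  let x : ℕ → S := fun n => next^[n] ⟨⟨0, k₀, s⟩, hk₀, hst⟩
  have hx : ∀ n, x (n + 1) = next (x n) := fun n => Function.iterate_succ_apply' next n _
  have hmono : Monotone fun n => (x n).1.1 := by
    refine monotone_nat_of_le_succ fun n => ?_
    have := hlex (x n)
    rw [← hx] at this
    omega
  -- The counter cannot decrease forever, so the depth eventually rises.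
  have hgrow : ∀ k n, (x n).1.2.1 ≤ k → ∃ m, (x n).1.1 < (x m).1.1 := by
    intro k
    induction k with
    | zero =>
      intro n hn
      have := hlex (x n)
      rw [← hx] at this
      exact ⟨n + 1, by omega⟩
    | succ k ih =>
      intro n hn
      have := hlex (x n)
      rw [← hx] at this
      rcases this with ⟨h1, h2⟩ | h1
      · rw [← h1]
        exact ih (n + 1) (by omega)
      · exact ⟨n + 1, h1⟩
  have hunb : ∀ N, ∃ n, N ≤ (x n).1.1 := by
    intro N
    induction N with
    | zero => exact ⟨0, Nat.zero_le _⟩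
    | succ N ih =>
      obtain ⟨n, hn⟩ := ih
      obtain ⟨m, hm⟩ := hgrow _ n le_rfl
      exact ⟨m, by omega⟩
  choose e he hbeta using fun n => hstep (x n)
  refine redInf_of_nat_seq (fun n => (x n).1.2.2) e t (fun n => ?_) fun N => ?_
  · rw [hx]
    exact hbeta n
  · obtain ⟨n₀, h1⟩ := hunb N
    refine ⟨n₀, fun n hn => ?_⟩
    have h2 : N ≤ (x n).1.1 := h1.trans (hmono hn)
    exact ⟨h2.trans (he n), (x n).2.1.agree.mono h2⟩

/-! ### Conclusions -/

theorem redInf_iff_redStd {s t : Term a b c} : RedInf s t ↔ RedStd s t :=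
  ⟨RedInf.redStd, RedStd.redInf⟩

theorem redCoind_iff_redStd {s t : Term a b c} : RedCoind s t ↔ RedStd s t :=
  ⟨fun ⟨γ, _, h⟩ => (redI_iff_redStd γ).1 h,
    fun h => ⟨0, Ordinal.omega_pos 1, (redI_iff_redStd 0).2 h⟩⟩

/-- As all the relations `⟶^∞_δ` coincide with the standard one, which absorbs β-steps on the
right, the finite reduction in the conclusion can be taken empty. -/
theorem propertyQ (a b c : Bool) : PropertyQ a b c := by
  rintro δ s t t' - h ⟨d, ht⟩
  exact ⟨s, .refl, (redI_iff_redStd δ).2 (RedStd.tail_betaAt ht ((redI_iff_redStd δ).1 h))⟩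

theorem hasCompression (a b c : Bool) : HasCompression a b c := fun s t => by
  rw [redOmega_eq_redStd, redInf_iff_redStd]

end InfLam

theorem mainTheorem5 (a b c : Bool) :
    InfLam.PropertyQ a b c ∧
    InfLam.HasCompression a b c ∧
    (∀ s t : InfLam.Term a b c, InfLam.RedCoind s t ↔ InfLam.RedStd s t) ∧
    (∀ s t : InfLam.Term a b c, InfLam.RedInf s t ↔ InfLam.RedStd s t) :=
  ⟨InfLam.propertyQ a b c, InfLam.hasCompression a b c, fun _ _ => InfLam.redCoind_iff_redStd,
    fun _ _ => InfLam.redInf_iff_redStd⟩
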